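/- For an odd prime $p$, integers $r\ge 1$, $\lambda$, and integers $K,L,M,N$ with $0\le K<K+M<p$ and $0\le L<L+N<p$, let $T_r(K,M;L,N;\lambda)$ be the number of solutions of $$\sum_{i=1}^{r} n_i!\,m_i!\equiv\lambda \pmod p,\qquad K+1\le m_1,\dots,m_r\le K+M,\quad L+1\le n_1,\dots,n_r\le L+N .$$ For all positive integers $k,\ell,r$ there is a constant $c=c(k,\ell,r)>0$ such that for every positive integer $s\le r/2$, every odd prime $p$, all $K,L,M,N$ as above with $N^2\ge M\ge N^{1/2}$, and every integer $\lambda$, $$\left|T_r(K,M;L,N;\lambda)-\frac{(MN)^r}{p}\right|\le c\, M^{\,r-1+\frac{1}{2s}-\frac{r-2s}{2\ell(k+1)}}\; N^{\,r-\frac{1}{2(s+1)}-\frac{r-2s}{2k(\ell+1)}}\; p^{\frac{r-2s}{2k\ell}} .$$ Moreover, there is an absolute constant $C>0$ such that for every odd prime $p$ there is an integer $N$ with $1\le N<p$ and $N\le Cp^{33/34}$ for which every residue class $\lambda$ modulo $p$ can be written as $$m_1!\,n_1!+m_2!\,n_2!+\dots+m_7!\,n_7!\equiv\lambda\pmod p,\qquad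 1\le m_i,n_i\le N\quad(1\le i\le 7).$$ -/

import Mathlib

open scoped Nat

/-- The number of solutions of `∑ i, (n i)! * (m i)! ≡ lam (mod p)` in `r` pairs of integers with
`K + 1 ≤ m i ≤ K + M` and `L + 1 ≤ n i ≤ L + N`. -/
def doubleFactorialCount (p r K M L N : ℕ) (lam : ℤ) : ℕ :=
  (((Fintype.piFinset fun _ : Fin r => Finset.Icc (K + 1) (K + M)) ×ˢ
      (Fintype.piFinset fun _ : Fin r => Finset.Icc (L + 1) (L + N))).filter
    fun mn => (∑ i : Fin r, (((mn.2 i)! * (mn.1 i)! : ℕ) : ℤ)) ≡ lam [ZMOD (p : ℤ)]).card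

/-!
The count of solutions is the average over `a` modulo `p` of `W(a) ^ r * e(-a * lam / p)`, where
`W(a) = ∑ e(a * m! * n! / p)` over the box. The frequency `a = 0` gives the main term
`(M * N) ^ r / p`. At the others `r - 2s` factors `|W(a)|` are bounded pointwise and the remaining
`2s` on average, so everything rests on even moments, written here in normalised form (`moment`).

*Moments.* The basic estimate is the sliding window inequality `moment_window_le`. An interval of
length `X` is covered `H` times by windows of length `H`, so by Hölder's inequality the moment of
order `2s` is bounded by the number of solutions in which all `m i` lie in one window, say
`m i = n + h i`. Dividing by `n!` turns the congruence, for fixed offsets `h`, into a polynomial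
equation in `n` of degree less than `H`, which has at most `H` roots
(`card_factorial_relation_le`) unless all its coefficients in the basis of rising factorials
vanish. The latter means that the coefficients cancel within each fibre of `h`; by orthogonality,
with one frequency for each fibre, such trivial solutions are counted by a product of moments of
the other variable (`card_system_le`). No fibre is a singleton, because the coefficients are
nonzero modulo `p`, so `h` takes at most `s` values.

*Consequences.* Without a second variable and with `H` about `X ^ (1 / (s + 1))` this gives
`exists_moment_factorial_le`. Inserting that bound for the second variable and choosing `H` anew
gives `exists_moment_factorialMul_le`; the shape of its exponents means that the trivial solutions
with constant `h` dominate, which needs the longer side to be at most the square of the shorter.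

*Pointwise bound.* For `a ≠ 0`, two applications of Hölder's inequality and Parseval's identity
bound `|W(a)| ^ (2 * k * l)` by the moments of order `2k` and `2l` of the two single sums
(`norm_expSum_mul_pow_le`).

*Seven summands.* With `r = 7` and `s = k = l = 2` the main term exceeds the error once `N` is a
large multiple of `p ^ (33 / 34)`. If that multiple is not below `p`, then `N = p - 1` is allowed,
and Wilson's theorem shows that the products of two factorials fill more than half of the residue
classes, so that already two of them sum to any given class.
-/

/-! ### Exponential sums and their normalised moments -/

/-- The sign `+1` on the first `s` indices and `-1` on the last `s` ones. -/
def pmSign (p s : ℕ) : Fin s ⊕ Fin s → ZMod p := Sum.elim (fun _ => 1) (fun _ => -1)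

/-- The exponential sum `∑ j ∈ T, e(a * g j / p)`. -/
noncomputable def expSum {p : ℕ} [NeZero p] {ι : Type*} (T : Finset ι) (g : ι → ZMod p)
    (a : ZMod p) : ℂ :=
  ∑ j ∈ T, ZMod.stdAddChar (a * g j)

/-- The normalised moment `p⁻¹ * ∑ a, (|expSum T g a| / #T) ^ d`; it lies in `[0, 1]`.
For empty `T` the base is `0 / 0 = 0`. -/
noncomputable def moment {p : ℕ} [NeZero p] {ι : Type*} (d : ℕ) (T : Finset ι)
    (g : ι → ZMod p) : ℝ :=
  (∑ a : ZMod p, (‖expSum T g a‖ / T.card) ^ d) / p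

/-- The number of solutions of `g j₁ + ⋯ + g jₛ = g jₛ₊₁ + ⋯ + g j₂ₛ` with all `jᵢ ∈ T`. -/
def diagonalCount {p : ℕ} {ι : Type*} (s : ℕ) (T : Finset ι) (g : ι → ZMod p) : ℕ :=
  ((Fintype.piFinset fun _ : Fin s ⊕ Fin s => T).filter
    fun j => ∑ i, pmSign p s i * g (j i) = 0).card

lemma stdAddChar_sum {p : ℕ} [NeZero p] {κ : Type*} (S : Finset κ) (f : κ → ZMod p) :
    (ZMod.stdAddChar (∑ i ∈ S, f i) : ℂ) = ∏ i ∈ S, ZMod.stdAddChar (f i) := by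
  classical
  induction S using Finset.induction_on with
  | empty => simp
  | insert i S hi ih => rw [Finset.sum_insert hi, Finset.prod_insert hi, AddChar.map_add_eq_mul, ih]

lemma diagonalCount_le {p : ℕ} {ι : Type*} (s : ℕ) (T : Finset ι) (g : ι → ZMod p) :
    diagonalCount s T g ≤ T.card ^ (2 * s) := by
  refine (Finset.card_filter_le _ _).trans ?_
  simp [two_mul]

section Basic

variable {p : ℕ} [NeZero p] {ι : Type*} (T : Finset ι) (g : ι → ZMod p)

lemma norm_expSum_le (a : ZMod p) : ‖expSum T g a‖ ≤ T.card := by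
  refine (norm_sum_le _ _).trans ?_
  simp

lemma norm_expSum_div_le_one (a : ZMod p) : ‖expSum T g a‖ / T.card ≤ 1 :=
  div_le_one_of_le₀ (norm_expSum_le T g a) (Nat.cast_nonneg _)

lemma expSum_neg (a : ZMod p) : expSum T g (-a) = (starRingEnd ℂ) (expSum T g a) := by
  simp only [expSum, map_sum, neg_mul, AddChar.map_neg_eq_conj]

lemma moment_nonneg (d : ℕ) : 0 ≤ moment d T g := by
  unfold moment; positivity

lemma moment_zero : moment 0 T g = 1 := by
  simp [moment, ZMod.card, NeZero.ne p]

lemma moment_anti {d e : ℕ} (h : d ≤ e) : moment e T g ≤ moment d T g := by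
  unfold moment
  gcongr ?_ / _
  exact Finset.sum_le_sum fun a _ =>
    pow_le_pow_of_le_one (by positivity) (norm_expSum_div_le_one T g a) h

lemma moment_le_one (d : ℕ) : moment d T g ≤ 1 :=
  (moment_anti T g (Nat.zero_le d)).trans_eq (moment_zero T g)

lemma sum_stdAddChar_mul (x : ZMod p) :
    ∑ a : ZMod p, (ZMod.stdAddChar (a * x) : ℂ) = if x = 0 then (p : ℂ) else 0 := by
  rw [AddChar.sum_mulShift x (ZMod.isPrimitive_stdAddChar p)]
  split_ifs <;> simp [ZMod.card]

/-- Expansion of a product of exponential sums over the index type `κ`. -/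
lemma prod_expSum {κ : Type*} [Fintype κ] [DecidableEq κ] (a : κ → ZMod p) :
    ∏ i, expSum T g (a i) =
      ∑ j ∈ Fintype.piFinset fun _ : κ => T, ZMod.stdAddChar (∑ i, a i * g (j i)) := by
  simp only [expSum, Finset.prod_univ_sum, stdAddChar_sum]

lemma norm_expSum_pow (s : ℕ) (a : ZMod p) :
    ((‖expSum T g a‖ : ℂ)) ^ (2 * s) =
      ∑ j ∈ Fintype.piFinset fun _ : Fin s ⊕ Fin s => T,
        ZMod.stdAddChar (a * ∑ i, pmSign p s i * g (j i)) := by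
  have h := prod_expSum T g (fun i => a * pmSign p s i)
  simp only [Fintype.prod_sum_type, pmSign, Sum.elim_inl, Sum.elim_inr, mul_one, mul_neg,
    expSum_neg, Finset.prod_const, Finset.card_univ, Fintype.card_fin] at h
  rw [pow_mul, ← Complex.mul_conj', mul_pow, h]
  refine Finset.sum_congr rfl fun j _ => ?_
  congr 1
  simp [pmSign, Fintype.sum_sum_type, Finset.mul_sum, mul_add]

lemma sum_norm_expSum_pow (s : ℕ) :
    ∑ a : ZMod p, ‖expSum T g a‖ ^ (2 * s) = p * diagonalCount s T g := by
  have h : ((∑ a : ZMod p, ‖expSum T g a‖ ^ (2 * s) : ℝ) : ℂ) = p * diagonalCount s T g := by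
    push_cast
    simp only [norm_expSum_pow]
    rw [Finset.sum_comm]
    simp only [sum_stdAddChar_mul]
    rw [← Finset.sum_filter, Finset.sum_const, diagonalCount, nsmul_eq_mul, mul_comm]
  exact_mod_cast h

lemma moment_two_mul (s : ℕ) :
    moment (2 * s) T g = diagonalCount s T g / (T.card : ℝ) ^ (2 * s) := by
  have hp : (p : ℝ) ≠ 0 := Nat.cast_ne_zero.2 (NeZero.ne p)
  simp only [moment, div_pow, ← Finset.sum_div, sum_norm_expSum_pow]
  field_simp

/-- The number of solutions of a system of linear equations, one for each fibre of `h`, factors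
over the fibres. This is the only place where odd moments are needed. -/
lemma card_system_le {κ I : Type*} [Fintype κ] [DecidableEq κ] [Fintype I] [DecidableEq I]
    (hT : T.Nonempty) (h : I → κ) (ε : I → ZMod p) (hε : ∀ i, ε i = 1 ∨ ε i = -1) :
    (((Fintype.piFinset fun _ : I => T).filter
        fun b => ∀ v, ∑ i with h i = v, ε i * g (b i) = 0).card : ℝ) / (T.card : ℝ) ^ Fintype.card I
      ≤ ∏ v, moment (Finset.univ.filter fun i => h i = v).card T g := by
  have hp : (p : ℝ) ≠ 0 := Nat.cast_ne_zero.2 (NeZero.ne p)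
  have hT' : (T.card : ℝ) ≠ 0 := Nat.cast_ne_zero.2 hT.card_pos.ne'
  set c : ℕ := ((Fintype.piFinset fun _ : I => T).filter
        fun b => ∀ v, ∑ i with h i = v, ε i * g (b i) = 0).card with hc
  -- detect each equation by orthogonality, with an independent frequency for each fibre
  have key : ((p : ℂ) ^ Fintype.card κ) * c =
      ∑ a : κ → ZMod p, ∏ i, expSum T g (a (h i) * ε i) := by
    have h1 : ∀ b : I → ι, ∑ a : κ → ZMod p,
        (ZMod.stdAddChar (∑ i, (a (h i) * ε i) * g (b i)) : ℂ) =
        if (∀ v, ∑ i with h i = v, ε i * g (b i) = 0) then (p : ℂ) ^ Fintype.card κ else 0 := by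
      intro b
      have h2 : ∀ a : κ → ZMod p, (ZMod.stdAddChar (∑ i, (a (h i) * ε i) * g (b i)) : ℂ) =
          ∏ v, ZMod.stdAddChar (a v * ∑ i with h i = v, ε i * g (b i)) := by
        intro a
        rw [← stdAddChar_sum]
        congr 1
        rw [← Finset.sum_fiberwise _ h]
        refine Finset.sum_congr rfl fun v _ => ?_
        rw [Finset.mul_sum]
        refine Finset.sum_congr rfl fun i hi => ?_
        rw [(Finset.mem_filter.1 hi).2, mul_assoc]
      simp only [h2]
      have h3 := Finset.prod_univ_sum (fun _ : κ => (Finset.univ : Finset (ZMod p)))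
        (fun v x => (ZMod.stdAddChar (x * ∑ i with h i = v, ε i * g (b i)) : ℂ))
      rw [Fintype.piFinset_univ] at h3
      rw [← h3]
      simp only [sum_stdAddChar_mul]
      split_ifs with h4
      · simp [h4]
      · push Not at h4
        obtain ⟨v, hv⟩ := h4
        exact Finset.prod_eq_zero (Finset.mem_univ v) (by simp [hv])
    simp only [prod_expSum]
    rw [Finset.sum_comm]
    simp only [h1]
    rw [← Finset.sum_filter, Finset.sum_const, nsmul_eq_mul, mul_comm]
  have hnorm : ∀ (a : κ → ZMod p) (i : I),
      ‖expSum T g (a (h i) * ε i)‖ = ‖expSum T g (a (h i))‖ := by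
    intro a i
    rcases hε i with h1 | h1 <;> simp [h1, expSum_neg]
  have key2 : (p : ℝ) ^ Fintype.card κ * c ≤
      ∏ v, ∑ x : ZMod p, ‖expSum T g x‖ ^ (Finset.univ.filter fun i => h i = v).card := by
    have h5 : (p : ℝ) ^ Fintype.card κ * c = ‖((p : ℂ) ^ Fintype.card κ) * c‖ := by simp
    rw [h5, key, Finset.prod_univ_sum, Fintype.piFinset_univ]
    refine (norm_sum_le _ _).trans (Finset.sum_le_sum fun a _ => ?_)
    rw [norm_prod]
    simp only [hnorm]
    rw [← Finset.prod_fiberwise' _ h (fun v => ‖expSum T g (a v)‖)]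
    simp
  have hcard : Fintype.card I = ∑ v, (Finset.univ.filter fun i => h i = v).card := by
    simpa using Finset.card_eq_sum_card_fiberwise (f := h) (s := Finset.univ) (t := Finset.univ)
      (by simp)
  have e : ∏ v, moment (Finset.univ.filter fun i => h i = v).card T g =
      (∏ v, ∑ x : ZMod p, ‖expSum T g x‖ ^ (Finset.univ.filter fun i => h i = v).card) /
        ((T.card : ℝ) ^ Fintype.card I * (p : ℝ) ^ Fintype.card κ) := by
    simp only [moment, div_pow, ← Finset.sum_div, Finset.prod_div_distrib]
    rw [Finset.prod_pow_eq_pow_sum, ← hcard, div_div]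
    simp
  rw [e, div_le_div_iff₀ (by positivity) (by positivity)]
  calc (c : ℝ) * ((T.card : ℝ) ^ Fintype.card I * (p : ℝ) ^ Fintype.card κ)
      = ((p : ℝ) ^ Fintype.card κ * c) * (T.card : ℝ) ^ Fintype.card I := by ring
    _ ≤ _ := by gcongr

end Basic

/-! ### Linear relations between shifted factorials -/

section Factorial

variable {p : ℕ} [Fact p.Prime]

lemma factorial_cast_ne_zero {n : ℕ} (hn : n < p) : ((n ! : ℕ) : ZMod p) ≠ 0 := by
  rw [Ne, ZMod.natCast_eq_zero_iff, (Fact.out : p.Prime).dvd_factorial]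
  omega

/-- The rising factorials, as a sequence of polynomials of consecutive degrees. -/
noncomputable def ascPochhammerSequence (R : Type*) [CommRing R] [IsDomain R] :
    Polynomial.Sequence R where
  elems' := ascPochhammer R
  degree_eq' n := by
    rw [Polynomial.degree_eq_natDegree (monic_ascPochhammer R n).ne_zero, ascPochhammer_natDegree]

lemma factorial_add_cast (R : Type*) [CommRing R] (n h : ℕ) :
    (((n + h)! : ℕ) : R) = n ! * (ascPochhammer R h).eval ((n + 1 : ℕ) : R) := by
  rw [← Nat.factorial_mul_ascFactorial, ← ascPochhammer_eval_cast,
    ascPochhammer_nat_eq_ascFactorial, Nat.cast_mul]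

/-- A nontrivial linear relation `∑ v < H, c v * (n + v)! = 0` modulo `p` has at most `H`
solutions `n` in an interval of integers below `p`: after division by `n!` it is a polynomial
equation of degree less than `H`. -/
lemma card_factorial_relation_le {H K X : ℕ} (hp : K + X < p) (c : Fin H → ZMod p) (hc : c ≠ 0) :
    ((Finset.Ioc K (K + X)).filter
      fun n => ∑ v, c v * (((n + v : ℕ)! : ℕ) : ZMod p) = 0).card ≤ H := by
  classical
  set G : Polynomial (ZMod p) := ∑ v, c v • ascPochhammer (ZMod p) (v : ℕ) with hG
  have hG0 : G ≠ 0 := by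
    intro h0
    apply hc
    have hli := (ascPochhammerSequence (ZMod p)).linearIndependent.comp _ (Fin.val_injective (n := H))
    exact funext (Fintype.linearIndependent_iff.1 hli c h0)
  have hdeg : G.natDegree ≤ H := by
    refine Polynomial.natDegree_sum_le_of_forall_le _ _ fun v _ => ?_
    refine (Polynomial.natDegree_smul_le _ _).trans ?_
    rw [ascPochhammer_natDegree]
    exact v.2.le
  have hle : ((Finset.Ioc K (K + X)).filter
      fun n => ∑ v, c v * (((n + v : ℕ)! : ℕ) : ZMod p) = 0).card ≤ G.roots.toFinset.card := by
    refine Finset.card_le_card_of_injOn (fun n => ((n + 1 : ℕ) : ZMod p)) ?_ ?_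
    · intro n hn
      simp only [Finset.coe_filter, Finset.mem_Ioc, Set.mem_ofPred_eq] at hn
      obtain ⟨hn1, hn2⟩ := hn
      simp only [Finset.mem_coe, Multiset.mem_toFinset, Polynomial.mem_roots hG0,
        Polynomial.IsRoot.def]
      have h3 : ((n ! : ℕ) : ZMod p) * G.eval ((n + 1 : ℕ) : ZMod p) = 0 := by
        rw [← hn2, hG, Polynomial.eval_finsetSum, Finset.mul_sum]
        refine Finset.sum_congr rfl fun v _ => ?_
        rw [factorial_add_cast, Polynomial.eval_smul, smul_eq_mul]
        ring
      exact (mul_eq_zero.1 h3).resolve_left (factorial_cast_ne_zero (by omega))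
    · intro n hn m hm hnm
      simp only [Finset.coe_filter, Finset.mem_Ioc, Set.mem_ofPred_eq] at hn hm
      have h4 : (n : ZMod p) = m := by simpa using hnm
      rw [ZMod.natCast_eq_natCast_iff'] at h4
      rwa [Nat.mod_eq_of_lt (by omega), Nat.mod_eq_of_lt (by omega)] at h4
  exact hle.trans ((Multiset.toFinset_card_le _).trans ((Polynomial.card_roots' _).trans hdeg))

end Factorial

/-! ### The sliding window inequality -/

/-- The elements `m` of `[K + 1, K + X]` with `u - H ≤ m < u`. -/
def window (K X H u : ℕ) : Finset ℕ :=
  (Finset.Icc (K + 1) (K + X)).filter fun m => m < u ∧ u ≤ m + H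

lemma card_window_le (K X H u : ℕ) : (window K X H u).card ≤ H := by
  have h : window K X H u ⊆ Finset.Ico (u - H) u := by
    intro m hm
    simp only [window, Finset.mem_filter, Finset.mem_Ico] at hm ⊢
    omega
  refine (Finset.card_le_card h).trans ?_
  rw [Nat.card_Ico]
  omega

/-- The number of solutions `(h, b)` for which all the partial sums over the fibres of `h`
vanish. -/
def fibrewiseCount {p : ℕ} {κ : Type*} (s H : ℕ) (B : Finset κ) (β : κ → ZMod p) : ℕ :=
  ∑ h : Fin s ⊕ Fin s → Fin H, ((Fintype.piFinset fun _ : Fin s ⊕ Fin s => B).filter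
    fun b => ∀ v, ∑ i with h i = v, pmSign p s i * β (b i) = 0).card

lemma sum_expSum_window {p : ℕ} [NeZero p] {κ : Type*} (K X H : ℕ) (B : Finset κ)
    (g : ℕ × κ → ZMod p) (a : ZMod p) :
    ∑ u ∈ Finset.Ioc K (K + X + H), expSum (window K X H u ×ˢ B) g a =
      H * expSum (Finset.Icc (K + 1) (K + X) ×ˢ B) g a := by
  simp only [expSum, Finset.sum_product, window, Finset.sum_filter]
  rw [Finset.sum_comm, Finset.mul_sum]
  refine Finset.sum_congr rfl fun m hm => ?_
  rw [Finset.mem_Icc] at hm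
  rw [← Finset.sum_filter, Finset.sum_const, nsmul_eq_mul]
  have h : (Finset.Ioc K (K + X + H)).filter (fun u => m < u ∧ u ≤ m + H) =
      Finset.Ioc m (m + H) := by
    ext u
    simp only [Finset.mem_filter, Finset.mem_Ioc]
    omega
  rw [h, Nat.card_Ioc, Nat.add_sub_cancel_left]

lemma diagonalCount_le_sum_window {p : ℕ} [NeZero p] {κ : Type*} (K X H n s : ℕ)
    (hs : 2 * s = n + 1) (B : Finset κ) (g : ℕ × κ → ZMod p) :
    (H : ℝ) ^ (2 * s) * diagonalCount s (Finset.Icc (K + 1) (K + X) ×ˢ B) g ≤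
      ((X + H : ℕ) : ℝ) ^ n *
        ∑ u ∈ Finset.Ioc K (K + X + H), (diagonalCount s (window K X H u ×ˢ B) g : ℝ) := by
  have hp : (0 : ℝ) < p := Nat.cast_pos.2 (NeZero.pos p)
  have h1 : ∀ a : ZMod p,
      (H : ℝ) ^ (2 * s) * ‖expSum (Finset.Icc (K + 1) (K + X) ×ˢ B) g a‖ ^ (2 * s) ≤
      ((X + H : ℕ) : ℝ) ^ n * ∑ u ∈ Finset.Ioc K (K + X + H),
        ‖expSum (window K X H u ×ˢ B) g a‖ ^ (2 * s) := by
    intro a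
    have h2 : (H : ℝ) * ‖expSum (Finset.Icc (K + 1) (K + X) ×ˢ B) g a‖ ≤
        ∑ u ∈ Finset.Ioc K (K + X + H), ‖expSum (window K X H u ×ˢ B) g a‖ := by
      have h3 := norm_sum_le (Finset.Ioc K (K + X + H))
        (fun u => expSum (window K X H u ×ˢ B) g a)
      rw [sum_expSum_window] at h3
      simpa using h3
    rw [← mul_pow, hs]
    refine (pow_le_pow_left₀ (by positivity) h2 _).trans
      ((pow_sum_le_card_mul_sum_pow (fun _ _ => norm_nonneg _) n).trans_eq ?_)
    rw [Nat.card_Ioc, add_assoc, Nat.add_sub_cancel_left]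
  have h5 := Finset.sum_le_sum fun a (_ : a ∈ (Finset.univ : Finset (ZMod p))) => h1 a
  rw [← Finset.mul_sum, ← Finset.mul_sum, Finset.sum_comm] at h5
  simp only [sum_norm_expSum_pow] at h5
  rw [← Finset.mul_sum] at h5
  refine le_of_mul_le_mul_left ?_ hp
  linarith

lemma diagonalCount_window_le {p : ℕ} {κ : Type*} (K X H n s : ℕ) (B : Finset κ)
    (β : κ → ZMod p) :
    diagonalCount s (window K X H (n + H) ×ˢ B) (fun z => ((z.1 ! : ℕ) : ZMod p) * β z.2) ≤
      ((Finset.univ ×ˢ (Fintype.piFinset fun _ : Fin s ⊕ Fin s => B)).filter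
        fun z : (Fin s ⊕ Fin s → Fin H) × (Fin s ⊕ Fin s → κ) =>
          ∑ i, pmSign p s i * β (z.2 i) * (((n + z.1 i : ℕ)! : ℕ) : ZMod p) = 0).card := by
  classical
  refine le_trans (Finset.card_le_card ?_) (Finset.card_image_le
    (f := fun z : (Fin s ⊕ Fin s → Fin H) × (Fin s ⊕ Fin s → κ) =>
      fun i => ((n + z.1 i : ℕ), z.2 i)))
  intro j hj
  simp only [Finset.mem_filter, Fintype.mem_piFinset, Finset.mem_product, window,
    Finset.mem_Icc] at hj
  obtain ⟨hj1, hj2⟩ := hj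
  have hlt : ∀ i, n ≤ (j i).1 ∧ (j i).1 - n < H := fun i => by have := (hj1 i).1; omega
  rw [Finset.mem_image]
  refine ⟨(fun i => ⟨(j i).1 - n, (hlt i).2⟩, fun i => (j i).2), ?_, ?_⟩
  · simp only [Finset.mem_filter, Finset.mem_product, Finset.mem_univ, true_and,
      Fintype.mem_piFinset]
    refine ⟨fun i => (hj1 i).2, ?_⟩
    rw [← hj2]
    refine Finset.sum_congr rfl fun i _ => ?_
    rw [Nat.add_sub_cancel' (hlt i).1]
    ring
  · funext i
    simp [Nat.add_sub_cancel' (hlt i).1]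

/-- Solutions in a window are counted by fixing the offsets from the start `n` of the window:
unless the resulting linear relation between `(n + v)!` is trivial, it has at most `H` solutions
`n`. -/
lemma sum_diagonalCount_window_le {p : ℕ} [Fact p.Prime] {κ : Type*} (K X H s : ℕ)
    (hp : K + X < p) (B : Finset κ) (β : κ → ZMod p) :
    ∑ u ∈ Finset.Ioc K (K + X + H), diagonalCount s (window K X H u ×ˢ B)
        (fun z => ((z.1 ! : ℕ) : ZMod p) * β z.2) ≤
      2 * H * (H * B.card) ^ (2 * s) + X * fibrewiseCount s H B β := by
  classical
  set S := (Finset.univ : Finset (Fin s ⊕ Fin s → Fin H)) ×ˢ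
    (Fintype.piFinset fun _ : Fin s ⊕ Fin s => B) with hS
  have hScard : S.card = (H * B.card) ^ (2 * s) := by
    simp [hS, mul_pow, two_mul]
  rw [← Finset.sum_Ioc_consecutive _ (Nat.le_add_right K H) (by omega : K + H ≤ K + X + H)]
  -- the windows that stick out of the interval on the left are few, hence bounded trivially
  have h1 : ∑ u ∈ Finset.Ioc K (K + H), diagonalCount s (window K X H u ×ˢ B)
      (fun z => ((z.1 ! : ℕ) : ZMod p) * β z.2) ≤ H * (H * B.card) ^ (2 * s) := by
    refine (Finset.sum_le_card_nsmul _ _ ((H * B.card) ^ (2 * s)) fun u _ => ?_).trans ?_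
    · refine (diagonalCount_le _ _ _).trans ?_
      rw [Finset.card_product]
      gcongr
      exact card_window_le K X H u
    · simp
  have h2 : ∑ u ∈ Finset.Ioc (K + H) (K + X + H), diagonalCount s (window K X H u ×ˢ B)
      (fun z => ((z.1 ! : ℕ) : ZMod p) * β z.2) =
      ∑ n ∈ Finset.Ioc K (K + X), diagonalCount s (window K X H (n + H) ×ˢ B)
      (fun z => ((z.1 ! : ℕ) : ZMod p) * β z.2) := by
    refine Finset.sum_nbij' (fun u => u - H) (fun n => n + H) ?_ ?_ ?_ ?_ ?_ <;>
      intro u hu <;> simp only [Finset.mem_Ioc] at hu ⊢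
    · omega
    · omega
    · omega
    · omega
    · rw [Nat.sub_add_cancel (by omega)]
  have h3 : ∑ n ∈ Finset.Ioc K (K + X), diagonalCount s (window K X H (n + H) ×ˢ B)
      (fun z => ((z.1 ! : ℕ) : ZMod p) * β z.2) ≤
      ∑ z ∈ S, ((Finset.Ioc K (K + X)).filter fun n =>
        ∑ i, pmSign p s i * β (z.2 i) * (((n + z.1 i : ℕ)! : ℕ) : ZMod p) = 0).card := by
    refine (Finset.sum_le_sum fun n _ => diagonalCount_window_le K X H n s B β).trans_eq ?_
    simp only [Finset.card_filter]
    rw [Finset.sum_comm]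
  have h4 : ∀ z ∈ S, ((Finset.Ioc K (K + X)).filter fun n =>
        ∑ i, pmSign p s i * β (z.2 i) * (((n + z.1 i : ℕ)! : ℕ) : ZMod p) = 0).card ≤
      H + X * (if ∀ v, ∑ i with z.1 i = v, pmSign p s i * β (z.2 i) = 0 then 1 else 0) := by
    intro z _
    split_ifs with hz
    · refine (Finset.card_filter_le _ _).trans ?_
      rw [Nat.card_Ioc]
      omega
    · have h5 := card_factorial_relation_le hp
        (fun v : Fin H => ∑ i with z.1 i = v, pmSign p s i * β (z.2 i))
        (fun h => hz fun v => congrFun h v)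
      refine le_trans (le_of_eq ?_) (h5.trans (Nat.le_add_right _ _))
      congr 1
      refine Finset.filter_congr fun n _ => ?_
      rw [← Finset.sum_fiberwise _ z.1]
      refine Eq.congr (Finset.sum_congr rfl fun v _ => ?_) rfl
      rw [Finset.sum_mul]
      refine Finset.sum_congr rfl fun i hi => ?_
      rw [(Finset.mem_filter.1 hi).2]
  have h6 : ∑ z ∈ S, (if ∀ v, ∑ i with z.1 i = v, pmSign p s i * β (z.2 i) = 0 then 1 else 0) =
      fibrewiseCount s H B β := by
    rw [hS, Finset.sum_product, fibrewiseCount]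
    simp only [Finset.card_filter]
  have h7 := Finset.sum_le_sum h4
  rw [Finset.sum_add_distrib, ← Finset.mul_sum, h6, Finset.sum_const, hScard, smul_eq_mul] at h7
  rw [h2]
  linarith [h3.trans h7, h1]

section Fibres

/-- The maps `h` from the index set of `2s` variables to `Fin H` none of whose fibres is a
singleton. Only these carry trivial solutions. -/
def noSingletonFibre (s H : ℕ) : Finset (Fin s ⊕ Fin s → Fin H) :=
  Finset.univ.filter fun h => ∀ v, (Finset.univ.filter fun i => h i = v).card ≠ 1

/-- The sum, over the maps `h` without singleton fibres, of the product of the moments whose orders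
are the sizes of the fibres of `h`. It bounds the number of trivial solutions, normalised by the
number of choices of the variables in `B`. -/
noncomputable def fibreMomentSum {p : ℕ} [NeZero p] {κ : Type*} (s H : ℕ) (B : Finset κ)
    (β : κ → ZMod p) : ℝ :=
  ∑ h ∈ noSingletonFibre s H, ∏ v, moment (Finset.univ.filter fun i => h i = v).card B β

lemma pmSign_eq (p s : ℕ) (i : Fin s ⊕ Fin s) : pmSign p s i = 1 ∨ pmSign p s i = -1 := by
  rcases i with i | i <;> simp [pmSign]

lemma fibrewiseCount_div_le {p : ℕ} [Fact p.Prime] {κ : Type*} (s H : ℕ) {B : Finset κ}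
    (hB : B.Nonempty) (β : κ → ZMod p) (hβ : ∀ b ∈ B, β b ≠ 0) :
    (fibrewiseCount s H B β : ℝ) / (B.card : ℝ) ^ (2 * s) ≤ fibreMomentSum s H B β := by
  unfold fibrewiseCount fibreMomentSum
  push_cast
  rw [Finset.sum_div, noSingletonFibre, Finset.sum_filter]
  refine Finset.sum_le_sum fun h _ => ?_
  split_ifs with hh
  · have := card_system_le B β hB h (pmSign p s) (pmSign_eq p s)
    rw [Fintype.card_sum, Fintype.card_fin, ← two_mul] at this
    refine (le_of_eq ?_).trans this
    -- the two sides differ only in a decidability instance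
    congr!
  · push Not at hh
    obtain ⟨v, hv⟩ := hh
    obtain ⟨i, hi⟩ := Finset.card_eq_one.1 hv
    rw [Finset.filter_eq_empty_iff.2, Finset.card_empty, Nat.cast_zero, zero_div]
    intro b hb hb2
    have h1 := hb2 v
    rw [hi, Finset.sum_singleton] at h1
    have h2 := hβ (b i) (Fintype.mem_piFinset.1 hb i)
    rcases pmSign_eq p s i with h3 | h3 <;> simp [h3, h2] at h1

/-- The sliding window inequality. The term `H / X` comes from the windows at the left end of the
interval and from the nontrivial solutions, the other one from the trivial solutions. -/
theorem moment_window_le {p : ℕ} [Fact p.Prime] {κ : Type*} {K X H s : ℕ} (hs : 0 < s)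
    (hH : 0 < H) (hHX : H ≤ X) (hp : K + X < p) {B : Finset κ} (hB : B.Nonempty)
    (β : κ → ZMod p) (hβ : ∀ b ∈ B, β b ≠ 0) :
    moment (2 * s) (Finset.Icc (K + 1) (K + X) ×ˢ B) (fun z => ((z.1 ! : ℕ) : ZMod p) * β z.2) ≤
      4 ^ s * ((H : ℝ) / X + fibreMomentSum s H B β / (H : ℝ) ^ (2 * s)) := by
  obtain ⟨n, hn⟩ : ∃ n, 2 * s = n + 1 := ⟨2 * s - 1, by omega⟩
  set D := diagonalCount s (Finset.Icc (K + 1) (K + X) ×ˢ B)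
    (fun z => ((z.1 ! : ℕ) : ZMod p) * β z.2) with hD
  have hX0 : (0 : ℝ) < X := Nat.cast_pos.2 (by omega)
  have hH0 : (0 : ℝ) < H := Nat.cast_pos.2 hH
  have hB0 : (0 : ℝ) < B.card := Nat.cast_pos.2 hB.card_pos
  have h1 := diagonalCount_le_sum_window K X H n s hn B
    (fun z => ((z.1 ! : ℕ) : ZMod p) * β z.2)
  have h2 : (∑ u ∈ Finset.Ioc K (K + X + H), (diagonalCount s (window K X H u ×ˢ B)
      (fun z => ((z.1 ! : ℕ) : ZMod p) * β z.2) : ℝ)) ≤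
      2 * H * (H * B.card) ^ (2 * s) + X * fibrewiseCount s H B β := by
    exact_mod_cast sum_diagonalCount_window_le K X H s hp B β
  have h3 := fibrewiseCount_div_le s H hB β hβ
  rw [div_le_iff₀ (by positivity)] at h3
  have hM : 0 ≤ fibreMomentSum s H B β := Finset.sum_nonneg fun h _ =>
    Finset.prod_nonneg fun v _ => moment_nonneg _ _ _
  have h4 : (H : ℝ) ^ (2 * s) * D ≤ (2 * X) ^ n * (2 * H * (H * B.card) ^ (2 * s) +
      X * (fibreMomentSum s H B β * (B.card : ℝ) ^ (2 * s))) := by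
    refine h1.trans ?_
    have h5 : ((X + H : ℕ) : ℝ) ≤ 2 * X := by
      have : (H : ℝ) ≤ X := Nat.cast_le.2 hHX
      push_cast
      linarith
    refine mul_le_mul (pow_le_pow_left₀ (Nat.cast_nonneg _) h5 n) (h2.trans ?_)
      (Finset.sum_nonneg fun _ _ => Nat.cast_nonneg _) (pow_nonneg (by linarith) n)
    exact add_le_add_right (mul_le_mul_of_nonneg_left h3 hX0.le) _
  rw [moment_two_mul, Finset.card_product, Nat.card_Icc, ← hD, div_le_iff₀ (by
    rw [show K + X + 1 - (K + 1) = X by omega]; push_cast; positivity)]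
  refine le_of_mul_le_mul_left (h4.trans ?_) (by positivity : (0 : ℝ) < (H : ℝ) ^ (2 * s))
  rw [show K + X + 1 - (K + 1) = X by omega]
  have h6 : (4 : ℝ) ^ s = 2 * 2 ^ n := by
    rw [show (4 : ℝ) = 2 ^ 2 by norm_num, ← pow_mul, hn, pow_succ]; ring
  have h7 : (H : ℝ) ^ (2 * s) * (4 ^ s * ((H : ℝ) / X + fibreMomentSum s H B β / (H : ℝ) ^ (2 * s)) *
      ((X * B.card : ℕ) : ℝ) ^ (2 * s)) = (2 * X) ^ n * (2 * H * (H * B.card) ^ (2 * s) +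
      2 * X * (fibreMomentSum s H B β * (B.card : ℝ) ^ (2 * s))) := by
    push_cast
    rw [h6, mul_pow (X : ℝ), mul_pow (H : ℝ), mul_pow (2 : ℝ), hn, pow_succ (X : ℝ)]
    field_simp
  rw [h7]
  refine mul_le_mul_of_nonneg_left (add_le_add_right ?_ _) (by positivity)
  rw [mul_assoc 2]
  have : 0 ≤ (X : ℝ) * (fibreMomentSum s H B β * (B.card : ℝ) ^ (2 * s)) := by positivity
  linarith

lemma two_mul_card_image_le {s H : ℕ} {h : Fin s ⊕ Fin s → Fin H}
    (hh : h ∈ noSingletonFibre s H) : (Finset.univ.image h).card ≤ s := by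
  have h1 := Finset.mul_card_image_le_card (f := h) Finset.univ 2 (fun v hv => by
    obtain ⟨i, -, hi⟩ := Finset.mem_image.1 hv
    have h2 : (Finset.univ.filter fun i => h i = v).card ≠ 0 :=
      Finset.card_ne_zero_of_mem (a := i) (by simp [hi])
    have h3 := (Finset.mem_filter.1 hh).2 v
    omega)
  simp only [Finset.card_univ, Fintype.card_sum, Fintype.card_fin] at h1
  omega

lemma card_image_eq_le (I : Type*) [Fintype I] [DecidableEq I] (H t : ℕ) :
    ((Finset.univ : Finset (I → Fin H)).filter fun h => (Finset.univ.image h).card = t).card ≤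
      H ^ t * t ^ Fintype.card I := by
  classical
  have h1 : ((Finset.univ : Finset (I → Fin H)).filter
      fun h => (Finset.univ.image h).card = t) ⊆
      (Finset.powersetCard t Finset.univ).biUnion fun S => Fintype.piFinset fun _ : I => S := by
    intro h hh
    rw [Finset.mem_biUnion]
    exact ⟨Finset.univ.image h, Finset.mem_powersetCard.2 ⟨Finset.subset_univ _,
      (Finset.mem_filter.1 hh).2⟩, by simp⟩
  refine (Finset.card_le_card h1).trans ((Finset.card_biUnion_le_card_mul _ _
    (t ^ Fintype.card I) fun S hS => ?_).trans ?_)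
  · simp [(Finset.mem_powersetCard.1 hS).2]
  · rw [Finset.card_powersetCard, Finset.card_univ, Fintype.card_fin]
    gcongr
    exact Nat.choose_le_pow H t

/-- The maps without singleton fibres are sorted by the number `t ≤ s` of their values. -/
lemma sum_noSingletonFibre_le {s H : ℕ} (hs : 0 < s) (F : (Fin s ⊕ Fin s → Fin H) → ℝ)
    (w : ℕ → ℝ) (hw : ∀ t, 0 ≤ w t)
    (hF : ∀ h ∈ noSingletonFibre s H, F h ≤ w (Finset.univ.image h).card) :
    ∑ h ∈ noSingletonFibre s H, F h ≤
      (s : ℝ) ^ (2 * s) * ∑ t ∈ Finset.Icc 1 s, (H : ℝ) ^ t * w t := by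
  refine (Finset.sum_le_sum hF).trans ?_
  have hmaps : ∀ h ∈ noSingletonFibre s H, (Finset.univ.image h).card ∈ Finset.Icc 1 s := by
    intro h hh
    rw [Finset.mem_Icc]
    refine ⟨Finset.card_pos.2 ?_, two_mul_card_image_le hh⟩
    exact ⟨h (Sum.inl ⟨0, hs⟩), Finset.mem_image_of_mem _ (Finset.mem_univ _)⟩
  rw [← Finset.sum_fiberwise_of_maps_to hmaps, Finset.mul_sum]
  refine Finset.sum_le_sum fun t ht => ?_
  rw [Finset.sum_congr rfl (g := fun _ => w t) fun h hh => by rw [(Finset.mem_filter.1 hh).2],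
    Finset.sum_const, nsmul_eq_mul, ← mul_assoc]
  refine mul_le_mul_of_nonneg_right ?_ (hw t)
  have h1 : ((noSingletonFibre s H).filter fun h => (Finset.univ.image h).card = t).card ≤
      H ^ t * t ^ (2 * s) := by
    refine (Finset.card_le_card (Finset.filter_subset_filter _ (Finset.subset_univ _))).trans ?_
    refine (card_image_eq_le _ H t).trans_eq ?_
    rw [Fintype.card_sum, Fintype.card_fin, two_mul]
  have h2 : t ^ (2 * s) ≤ s ^ (2 * s) := Nat.pow_le_pow_left (Finset.mem_Icc.1 ht).2 _
  have h3 := h1.trans (Nat.mul_le_mul_left _ h2)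
  rw [mul_comm (H ^ t)] at h3
  exact_mod_cast h3

lemma prod_moment_le_pow {p : ℕ} [NeZero p] {κ : Type*} {s H : ℕ} (B : Finset κ)
    (β : κ → ZMod p) {h : Fin s ⊕ Fin s → Fin H} (hh : h ∈ noSingletonFibre s H) :
    ∏ v, moment (Finset.univ.filter fun i => h i = v).card B β ≤
      moment 2 B β ^ (Finset.univ.image h).card := by
  rw [← Finset.prod_const, ← Finset.prod_subset (Finset.subset_univ (Finset.univ.image h))]
  · refine Finset.prod_le_prod (fun v _ => moment_nonneg _ _ _) fun v hv => moment_anti _ _ ?_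
    obtain ⟨i, -, hi⟩ := Finset.mem_image.1 hv
    have h2 : (Finset.univ.filter fun i => h i = v).card ≠ 0 :=
      Finset.card_ne_zero_of_mem (a := i) (by simp [hi])
    have h3 := (Finset.mem_filter.1 hh).2 v
    omega
  · intro v _ hv
    rw [Finset.filter_eq_empty_iff.2, Finset.card_empty, moment_zero]
    intro i _ hi
    exact hv (Finset.mem_image.2 ⟨i, Finset.mem_univ _, hi⟩)

lemma prod_moment_le_of_const {p : ℕ} [NeZero p] {κ : Type*} {s H : ℕ} (B : Finset κ)
    (β : κ → ZMod p) {h : Fin s ⊕ Fin s → Fin H} (hh : (Finset.univ.image h).card = 1) :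
    ∏ v, moment (Finset.univ.filter fun i => h i = v).card B β ≤ moment (2 * s) B β := by
  obtain ⟨v, hv⟩ := Finset.card_eq_one.1 hh
  have h1 : ∀ i, h i = v := fun i => by
    have := Finset.mem_image_of_mem h (Finset.mem_univ i)
    rwa [hv, Finset.mem_singleton] at this
  rw [Finset.prod_eq_single v]
  · simp [h1, two_mul]
  · intro u _ hu
    rw [Finset.filter_eq_empty_iff.2, Finset.card_empty, moment_zero]
    intro i _ hi
    exact hu (hi.symm.trans (h1 i))
  · simp

end Fibres

/-! ### Even moments of sums over factorials and over products of two factorials -/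

/-- The residue of `n!`. -/
def factorialMod (p n : ℕ) : ZMod p := (n ! : ℕ)

/-- The residue of `m! * n!`. -/
def factorialMulMod (p : ℕ) (z : ℕ × ℕ) : ZMod p := ((z.1 ! : ℕ) : ZMod p) * (z.2 ! : ℕ)

lemma ceil_le_two_mul {x : ℝ} (hx : 1 ≤ x) : (⌈x⌉₊ : ℝ) ≤ 2 * x := by
  have := Nat.ceil_lt_add_one (by linarith : 0 ≤ x)
  linarith

/-- The moment of order `2s` of the sum of `e(a * m! / p)` over an interval: the window inequality
with windows of length about `X ^ (1 / (s + 1))`. -/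
theorem exists_moment_factorial_le (s : ℕ) (hs : 0 < s) : ∃ C : ℝ, 0 < C ∧
    ∀ (p : ℕ) [Fact p.Prime] (K X : ℕ), 0 < X → K + X < p →
      moment (2 * s) (Finset.Icc (K + 1) (K + X)) (factorialMod p) ≤
        C * (X : ℝ) ^ (-(s : ℝ) / (s + 1)) := by
  refine ⟨4 ^ s * (2 + s ^ (2 * s) * s), by positivity, fun p _ K X hX hp => ?_⟩
  have hX1 : (1 : ℝ) ≤ X := Nat.one_le_cast.2 hX
  have hX0 : (0 : ℝ) < X := by linarith
  have hs0 : (0 : ℝ) < s := Nat.cast_pos.2 hs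
  set θ : ℝ := (X : ℝ) ^ (1 / ((s : ℝ) + 1)) with hθ
  have hθ1 : 1 ≤ θ := Real.one_le_rpow hX1 (by positivity)
  have hθ0 : 0 < θ := by linarith
  have hθX : θ ≤ X := by
    calc θ ≤ (X : ℝ) ^ (1 : ℝ) :=
          Real.rpow_le_rpow_of_exponent_le hX1 (by rw [div_le_one (by positivity)]; linarith)
      _ = X := Real.rpow_one _
  have hpow : θ ^ s * θ = X := by
    rw [← pow_succ, hθ, ← Real.rpow_natCast, ← Real.rpow_mul hX0.le]
    push_cast
    rw [one_div, inv_mul_cancel₀ (by positivity), Real.rpow_one]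
  have hR : (X : ℝ) ^ (-(s : ℝ) / (s + 1)) = (θ ^ s)⁻¹ := by
    rw [hθ, ← Real.rpow_natCast, ← Real.rpow_mul hX0.le, ← Real.rpow_neg hX0.le]
    congr 1
    ring
  set H := ⌈θ⌉₊ with hH
  have hHle : H ≤ X := Nat.ceil_le.2 hθX
  have hH0 : 0 < H := Nat.ceil_pos.2 hθ0
  have hθH : θ ≤ H := Nat.le_ceil θ
  have hH0' : (0 : ℝ) < H := Nat.cast_pos.2 hH0
  have h1 := moment_window_le (p := p) hs hH0 hHle hp (B := ({()} : Finset Unit)) (by simp)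
    (fun _ => 1) (by simp)
  have h2 : moment (2 * s) (Finset.Icc (K + 1) (K + X) ×ˢ ({()} : Finset Unit))
      (fun z => ((z.1 ! : ℕ) : ZMod p) * 1) =
      moment (2 * s) (Finset.Icc (K + 1) (K + X)) (factorialMod p) := by
    simp [moment, expSum, factorialMod]
  rw [h2] at h1
  have h3 : fibreMomentSum s H ({()} : Finset Unit) (fun _ => (1 : ZMod p)) ≤
      s ^ (2 * s) * (s * (H : ℝ) ^ s) := by
    refine (sum_noSingletonFibre_le hs _ (fun _ => 1) (fun _ => zero_le_one) fun h _ =>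
      Finset.prod_le_one (fun v _ => moment_nonneg _ _ _) fun v _ => moment_le_one _ _ _).trans ?_
    refine mul_le_mul_of_nonneg_left ?_ (by positivity)
    refine (Finset.sum_le_card_nsmul _ _ ((H : ℝ) ^ s) fun t ht => ?_).trans ?_
    · rw [mul_one]
      exact pow_le_pow_right₀ (Nat.one_le_cast.2 hH0) (Finset.mem_Icc.1 ht).2
    · simp
  refine h1.trans ?_
  rw [mul_assoc, hR]
  refine mul_le_mul_of_nonneg_left ?_ (by positivity)
  rw [add_mul]
  refine add_le_add ?_ ?_
  · rw [← hpow, div_le_iff₀ (by positivity)]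
    calc (H : ℝ) ≤ 2 * θ := ceil_le_two_mul hθ1
      _ = 2 * (θ ^ s)⁻¹ * (θ ^ s * θ) := by field_simp
  · calc fibreMomentSum s H ({()} : Finset Unit) (fun _ => (1 : ZMod p)) / (H : ℝ) ^ (2 * s)
        ≤ (s ^ (2 * s) * (s * (H : ℝ) ^ s)) / (H : ℝ) ^ (2 * s) := by gcongr
      _ = s ^ (2 * s) * s * ((H : ℝ) ^ s)⁻¹ := by
          rw [two_mul s, pow_add (H : ℝ)]; field_simp
      _ ≤ s ^ (2 * s) * s * (θ ^ s)⁻¹ := by gcongr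

/-- Among the trivial solutions whose offsets take `t` values, those with `t = 1` dominate; this
is where the longer interval has to be at most the square of the shorter one. -/
lemma trivial_solutions_exponent_le {s t x y : ℝ} (ht : 2 ≤ t) (hts : t ≤ s) (hy : 0 ≤ y)
    (hxy : x ≤ 2 * y) :
    (t - 2 * s) * (x / (2 * s) - y / (2 * (s + 1))) - t / 2 * y ≤
      (x / (2 * s) - y / (2 * (s + 1))) - x := by
  have hs : 0 < s := by linarith
  have h1 : (x / (2 * s) - y / (2 * (s + 1))) - x -
      ((t - 2 * s) * (x / (2 * s) - y / (2 * (s + 1))) - t / 2 * y) =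
      ((t - 1) * (s + 1) * (2 * y - x) + y * ((t - 2) * (s ^ 2 - 2) + (s - 2))) /
        (2 * s * (s + 1)) := by
    field_simp
    ring
  have h2 : 0 ≤ ((t - 1) * (s + 1) * (2 * y - x) + y * ((t - 2) * (s ^ 2 - 2) + (s - 2))) /
        (2 * s * (s + 1)) := by
    have a1 : 0 ≤ t - 1 := by linarith
    have a2 : 0 ≤ 2 * y - x := by linarith
    have a3 : 0 ≤ t - 2 := by linarith
    have a4 : 0 ≤ s ^ 2 - 2 := by nlinarith
    have a5 : 0 ≤ s - 2 := by linarith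
    positivity
  linarith

/-- The moment of order `2s` of the sum of `e(a * m! * n! / p)` over a box, when the range of `m`
is the longer one: the window inequality in `m` with windows of length about
`X ^ (1 / (2 * s)) * Y ^ (-1 / (2 * (s + 1)))`. -/
theorem exists_moment_factorialMul_le (s : ℕ) (hs : 0 < s) : ∃ C : ℝ, 0 < C ∧
    ∀ (p : ℕ) [Fact p.Prime] (K X L Y : ℕ), 0 < Y → Y ≤ X → (X : ℝ) ≤ (Y : ℝ) ^ 2 →
      K + X < p → L + Y < p →
      moment (2 * s) (Finset.Icc (K + 1) (K + X) ×ˢ Finset.Icc (L + 1) (L + Y))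
          (factorialMulMod p) ≤
        C * ((X : ℝ) ^ (-1 + 1 / (2 * (s : ℝ))) * (Y : ℝ) ^ (-(1 / (2 * ((s : ℝ) + 1))))) := by
  obtain ⟨C₁, hC₁, h2nd⟩ := exists_moment_factorial_le 1 one_pos
  obtain ⟨C₂, hC₂, h2s⟩ := exists_moment_factorial_le s hs
  set D : ℝ := C₂ + (1 + C₁) ^ s with hD
  refine ⟨4 ^ s * (2 + s ^ (2 * s) * (s * D)), by positivity,
    fun p _ K X L Y hY hYX hXY hp hq => ?_⟩
  have hY1 : (1 : ℝ) ≤ Y := Nat.one_le_cast.2 hY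
  have hY0 : (0 : ℝ) < Y := by linarith
  have hYX' : (Y : ℝ) ≤ X := Nat.cast_le.2 hYX
  have hX1 : (1 : ℝ) ≤ X := by linarith
  have hX0 : (0 : ℝ) < X := by linarith
  have hs0 : (0 : ℝ) < s := Nat.cast_pos.2 hs
  have hs1 : (1 : ℝ) ≤ s := Nat.one_le_cast.2 hs
  set x := Real.log X with hx
  set y := Real.log Y with hy
  have hy0 : 0 ≤ y := Real.log_nonneg hY1
  have hyx : y ≤ x := Real.log_le_log hY0 hYX'
  have hxy : x ≤ 2 * y := by
    have := Real.log_le_log hX0 hXY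
    rwa [Real.log_pow, Nat.cast_ofNat] at this
  set η : ℝ := x / (2 * s) - y / (2 * (s + 1)) with hη
  have hη0 : 0 ≤ η := by
    have : y / (2 * (s + 1)) ≤ x / (2 * s) := by
      gcongr
      linarith
    rw [hη]; linarith
  have hηx : η ≤ x := by
    have h1 : x / (2 * s) ≤ x := div_le_self (by linarith) (by linarith)
    have h2 : 0 ≤ y / (2 * (s + 1)) := by positivity
    rw [hη]; linarith
  have hXe : (X : ℝ) = Real.exp x := (Real.exp_log hX0).symm
  have hYe : (Y : ℝ) = Real.exp y := (Real.exp_log hY0).symm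
  set θ := Real.exp η with hθ
  have hθ1 : 1 ≤ θ := Real.one_le_exp hη0
  have hθ0 : 0 < θ := by linarith
  set H := ⌈θ⌉₊ with hH
  have hHle : H ≤ X := Nat.ceil_le.2 (by rw [hXe]; exact Real.exp_le_exp.2 hηx)
  have hH0 : 0 < H := Nat.ceil_pos.2 hθ0
  have hθH : θ ≤ H := Nat.le_ceil θ
  have hH0' : (0 : ℝ) < H := Nat.cast_pos.2 hH0
  set B := Finset.Icc (L + 1) (L + Y) with hB
  have hβ : ∀ b ∈ B, factorialMod p b ≠ 0 := fun b hb =>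
    factorial_cast_ne_zero (by have := (Finset.mem_Icc.1 hb).2; omega)
  have h1 := moment_window_le (p := p) hs hH0 hHle hp (B := B)
    (Finset.nonempty_Icc.2 (by omega)) (factorialMod p) hβ
  refine h1.trans ?_
  have hrhs : (X : ℝ) ^ (-1 + 1 / (2 * (s : ℝ))) * (Y : ℝ) ^ (-(1 / (2 * ((s : ℝ) + 1)))) =
      θ / X := by
    rw [Real.rpow_def_of_pos hX0, Real.rpow_def_of_pos hY0, hθ, hXe, ← Real.exp_add,
      ← Real.exp_sub, Real.log_exp]
    congr 1
    rw [hη]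
    ring
  rw [hrhs, mul_assoc]
  refine mul_le_mul_of_nonneg_left ?_ (by positivity)
  rw [add_mul]
  refine add_le_add ?_ ?_
  · rw [← mul_div_assoc]
    gcongr
    exact ceil_le_two_mul hθ1
  set w : ℕ → ℝ := fun t => if t = 1 then C₂ * (Y : ℝ) ^ (-(s : ℝ) / (s + 1)) else
    (C₁ * (Y : ℝ) ^ (-(1 : ℝ) / 2)) ^ t with hw
  have hw0 : ∀ t, 0 ≤ w t := fun t => by
    simp only [hw]
    split_ifs <;> positivity
  have h3 : fibreMomentSum s H B (factorialMod p) ≤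
      s ^ (2 * s) * ∑ t ∈ Finset.Icc 1 s, (H : ℝ) ^ t * w t := by
    refine sum_noSingletonFibre_le hs _ w hw0 fun h hh => ?_
    simp only [hw]
    split_ifs with ht
    · exact (prod_moment_le_of_const B _ ht).trans (h2s p L Y hY hq)
    · refine (prod_moment_le_pow B _ hh).trans (pow_le_pow_left₀ (moment_nonneg _ _ _) ?_ _)
      have := h2nd p L Y hY hq
      norm_num at this ⊢
      exact this
  have h4 : ∀ t ∈ Finset.Icc 1 s, (H : ℝ) ^ t * w t / (H : ℝ) ^ (2 * s) ≤ D * (θ / X) := by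
    intro t ht
    obtain ⟨ht1, hts⟩ := Finset.mem_Icc.1 ht
    have h5 : (H : ℝ) ^ t * w t / (H : ℝ) ^ (2 * s) ≤ Real.exp ((t - 2 * s) * η) * w t := by
      have h6 : Real.exp (((t : ℝ) - 2 * s) * η) = (θ ^ (2 * s - t))⁻¹ := by
        rw [hθ, ← Real.exp_nat_mul, ← Real.exp_neg, Nat.cast_sub (by omega)]
        congr 1
        push_cast
        ring
      have h7 : (H : ℝ) ^ (2 * s) = (H : ℝ) ^ t * (H : ℝ) ^ (2 * s - t) := by
        rw [← pow_add]; congr 1; omega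
      have h8 : (H : ℝ) ^ t * w t / (H : ℝ) ^ (2 * s) = ((H : ℝ) ^ (2 * s - t))⁻¹ * w t := by
        rw [h7]; field_simp
      rw [h8, h6]
      have := hw0 t
      gcongr
    refine h5.trans ?_
    have hθX : θ / X = Real.exp (η - x) := by rw [Real.exp_sub, ← hXe]
    rw [hθX]
    simp only [hw]
    split_ifs with ht2
    · have h9 : Real.exp (((t : ℝ) - 2 * s) * η) * (C₂ * (Y : ℝ) ^ (-(s : ℝ) / (s + 1))) =
          C₂ * Real.exp (η - x) := by
        rw [Real.rpow_def_of_pos hY0, mul_left_comm, ← Real.exp_add, ← hy, ht2, hη]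
        congr 2
        push_cast
        field_simp
        ring
      rw [h9]
      gcongr
      rw [hD]
      linarith [pow_pos (by linarith : 0 < 1 + C₁) s]
    · have h9 : Real.exp (((t : ℝ) - 2 * s) * η) * (C₁ * (Y : ℝ) ^ (-(1 : ℝ) / 2)) ^ t =
          C₁ ^ t * Real.exp (((t : ℝ) - 2 * s) * η - t / 2 * y) := by
        rw [Real.rpow_def_of_pos hY0, mul_pow, mul_left_comm, ← Real.exp_nat_mul, ← Real.exp_add,
          ← hy]
        congr 2
        ring
      rw [h9]
      have h10 : C₁ ^ t ≤ D := by
        calc C₁ ^ t ≤ (1 + C₁) ^ t := pow_le_pow_left₀ hC₁.le (by linarith) t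
          _ ≤ (1 + C₁) ^ s := pow_le_pow_right₀ (by linarith) hts
          _ ≤ D := by rw [hD]; linarith
      have h11 := trivial_solutions_exponent_le (s := (s : ℝ)) (t := (t : ℝ)) (x := x) (y := y)
        (by exact_mod_cast (by omega : 2 ≤ t)) (Nat.cast_le.2 hts) hy0 hxy
      gcongr
  calc fibreMomentSum s H B (factorialMod p) / (H : ℝ) ^ (2 * s)
      ≤ (s ^ (2 * s) * ∑ t ∈ Finset.Icc 1 s, (H : ℝ) ^ t * w t) / (H : ℝ) ^ (2 * s) := by gcongr
    _ = s ^ (2 * s) * ∑ t ∈ Finset.Icc 1 s, (H : ℝ) ^ t * w t / (H : ℝ) ^ (2 * s) := by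
        rw [mul_div_assoc, Finset.sum_div]
    _ ≤ s ^ (2 * s) * (s * (D * (θ / X))) := by
        gcongr
        refine (Finset.sum_le_card_nsmul _ _ _ h4).trans ?_
        simp
    _ = _ := by ring

/-- The moment of order `2s` of the sum of `e(a * m! * n! / p)` over a box whose sides are at most
the squares of each other. When `N` is the longer side, the bound for the interchanged roles is the
stronger one. -/
theorem exists_moment_factorialMul_box_le (s : ℕ) (hs : 0 < s) : ∃ C : ℝ, 0 < C ∧
    ∀ (p : ℕ) [Fact p.Prime] (K M L N : ℕ), 0 < M → 0 < N → (M : ℝ) ≤ (N : ℝ) ^ 2 →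
      (N : ℝ) ≤ (M : ℝ) ^ 2 → K + M < p → L + N < p →
      moment (2 * s) (Finset.Icc (K + 1) (K + M) ×ˢ Finset.Icc (L + 1) (L + N))
          (factorialMulMod p) ≤
        C * ((M : ℝ) ^ (-1 + 1 / (2 * (s : ℝ))) * (N : ℝ) ^ (-(1 / (2 * ((s : ℝ) + 1))))) := by
  obtain ⟨C, hC, h⟩ := exists_moment_factorialMul_le s hs
  refine ⟨C, hC, fun p _ K M L N hM hN hMN hNM hp hq => ?_⟩
  rcases le_total N M with hle | hle
  · exact h p K M L N hN hle hMN hp hq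
  have hswap : moment (2 * s) (Finset.Icc (K + 1) (K + M) ×ˢ Finset.Icc (L + 1) (L + N))
      (factorialMulMod p) = moment (2 * s) (Finset.Icc (L + 1) (L + N) ×ˢ
        Finset.Icc (K + 1) (K + M)) (factorialMulMod p) := by
    have hE : ∀ a : ZMod p, expSum (Finset.Icc (K + 1) (K + M) ×ˢ Finset.Icc (L + 1) (L + N))
        (factorialMulMod p) a = expSum (Finset.Icc (L + 1) (L + N) ×ˢ Finset.Icc (K + 1) (K + M))
        (factorialMulMod p) a := by
      intro a
      simp only [expSum, factorialMulMod, Finset.sum_product]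
      rw [Finset.sum_comm]
      simp only [mul_comm]
    simp only [moment, hE, Finset.card_product, mul_comm]
  rw [hswap]
  refine (h p L N K M hM hle hNM hq hp).trans ?_
  refine mul_le_mul_of_nonneg_left ?_ hC.le
  have hM1 : (1 : ℝ) ≤ M := Nat.one_le_cast.2 hM
  have hM0 : (0 : ℝ) < M := by linarith
  have hN0 : (0 : ℝ) < N := Nat.cast_pos.2 hN
  have hs1 : (1 : ℝ) ≤ s := Nat.one_le_cast.2 hs
  have hlog : Real.log M ≤ Real.log N := Real.log_le_log hM0 (Nat.cast_le.2 hle)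
  rw [Real.rpow_def_of_pos hM0, Real.rpow_def_of_pos hN0, Real.rpow_def_of_pos hM0,
    Real.rpow_def_of_pos hN0, ← Real.exp_add, ← Real.exp_add, Real.exp_le_exp]
  have h1 : 1 / (2 * (s : ℝ)) ≤ 1 / 2 := by
    rw [div_le_div_iff₀ (by positivity) (by positivity)]; linarith
  have h2 : 1 / (2 * ((s : ℝ) + 1)) ≤ 1 / 2 := by
    rw [div_le_div_iff₀ (by positivity) (by positivity)]; linarith
  nlinarith

/-! ### Bilinear bound for a single frequency -/

section Bilinear

variable {p : ℕ} [NeZero p] {ι : Type*}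

/-- Parseval's identity on `ZMod p`. -/
lemma sum_norm_sq_fourier (c : ZMod p → ℂ) :
    ∑ a : ZMod p, ‖∑ x, c x * ZMod.stdAddChar (a * x)‖ ^ 2 = p * ∑ x, ‖c x‖ ^ 2 := by
  have h : ((∑ a : ZMod p, ‖∑ x, c x * ZMod.stdAddChar (a * x)‖ ^ 2 : ℝ) : ℂ) =
      ((p * ∑ x, ‖c x‖ ^ 2 : ℝ) : ℂ) := by
    push_cast
    have h1 : ∀ a : ZMod p, (‖∑ x, c x * ZMod.stdAddChar (a * x)‖ : ℂ) ^ 2 =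
        ∑ x, ∑ y, c x * (starRingEnd ℂ) (c y) * ZMod.stdAddChar (a * (x - y)) := by
      intro a
      rw [← Complex.mul_conj', map_sum, Finset.sum_mul_sum]
      refine Finset.sum_congr rfl fun x _ => Finset.sum_congr rfl fun y _ => ?_
      rw [map_mul (starRingEnd ℂ), ← AddChar.map_neg_eq_conj, mul_sub, sub_eq_add_neg,
        AddChar.map_add_eq_mul]
      ring
    simp only [h1]
    rw [Finset.sum_comm, Finset.mul_sum]
    refine Finset.sum_congr rfl fun x _ => ?_
    rw [Finset.sum_comm]
    simp only [← Finset.mul_sum, sum_stdAddChar_mul, sub_eq_zero]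
    rw [Finset.sum_eq_single x]
    · rw [if_pos rfl, Complex.mul_conj']
      ring
    · intro y _ hy
      rw [if_neg (Ne.symm hy), mul_zero]
    · simp
  exact_mod_cast h

/-- The coefficient at `x` of the `k`-th power of `∑ j ∈ T, θ j * e(· * g j / p)`. For `θ = 1` it
is the number of representations of `x` as a sum of `k` values of `g`. -/
noncomputable def powCoeff (k : ℕ) (T : Finset ι) (g : ι → ZMod p) (θ : ι → ℂ) (x : ZMod p) : ℂ :=
  ∑ j ∈ (Fintype.piFinset fun _ : Fin k => T) with ∑ i, g (j i) = x, ∏ i, θ (j i)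

lemma weighted_expSum_pow (k : ℕ) (T : Finset ι) (g : ι → ZMod p) (θ : ι → ℂ) (a : ZMod p) :
    (∑ j ∈ T, θ j * ZMod.stdAddChar (a * g j)) ^ k =
      ∑ x, powCoeff k T g θ x * ZMod.stdAddChar (a * x) := by
  have h := Finset.prod_univ_sum (fun _ : Fin k => T)
    (fun _ j => θ j * (ZMod.stdAddChar (a * g j) : ℂ))
  rw [Finset.prod_const, Finset.card_univ, Fintype.card_fin] at h
  rw [h, ← Finset.sum_fiberwise _ (fun j : Fin k → ι => ∑ i, g (j i))]
  refine Finset.sum_congr rfl fun x _ => ?_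
  rw [powCoeff, Finset.sum_mul]
  refine Finset.sum_congr rfl fun j hj => ?_
  rw [← (Finset.mem_filter.1 hj).2, Finset.mul_sum, stdAddChar_sum, Finset.prod_mul_distrib]

lemma norm_powCoeff_le {p : ℕ} (k : ℕ) (T : Finset ι) (g : ι → ZMod p) (θ : ι → ℂ)
    (hθ : ∀ j, ‖θ j‖ ≤ 1) (x : ZMod p) : ‖powCoeff k T g θ x‖ ≤ ‖powCoeff k T g 1 x‖ := by
  have h1 : ‖powCoeff k T g 1 x‖ =
      (((Fintype.piFinset fun _ : Fin k => T).filter fun j => ∑ i, g (j i) = x).card : ℝ) := by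
    simp [powCoeff]
  rw [h1]
  refine (norm_sum_le _ _).trans ?_
  refine (Finset.sum_le_card_nsmul _ _ 1 fun j _ => ?_).trans (by simp)
  rw [norm_prod]
  exact Finset.prod_le_one (fun i _ => norm_nonneg _) fun i _ => hθ _

lemma sum_norm_powCoeff_one (k : ℕ) (T : Finset ι) (g : ι → ZMod p) :
    ∑ x, ‖powCoeff k T g 1 x‖ = (T.card : ℝ) ^ k := by
  have h := Finset.card_eq_sum_card_fiberwise (s := Fintype.piFinset fun _ : Fin k => T)
    (t := (Finset.univ : Finset (ZMod p))) (f := fun j => ∑ i, g (j i)) (by simp)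
  simp only [Fintype.card_piFinset, Finset.prod_const, Finset.card_univ, Fintype.card_fin] at h
  simp only [powCoeff, Pi.one_apply, Finset.prod_const_one, Finset.sum_const, nsmul_eq_mul, mul_one,
    Complex.norm_natCast]
  exact_mod_cast h.symm

lemma sum_norm_expSum_pow_eq (k : ℕ) (T : Finset ι) (g : ι → ZMod p) :
    ∑ a : ZMod p, ‖expSum T g a‖ ^ (2 * k) = p * ∑ x, ‖powCoeff k T g 1 x‖ ^ 2 := by
  rw [← sum_norm_sq_fourier]
  refine Finset.sum_congr rfl fun a _ => ?_
  rw [← weighted_expSum_pow, norm_pow, ← pow_mul, mul_comm k]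
  simp [expSum]

/-- Even moments do not increase beyond those of the unweighted sum when weights of absolute value
at most `1` are inserted. -/
lemma sum_norm_weighted_expSum_pow_le (k : ℕ) (T : Finset ι) (g : ι → ZMod p) (θ : ι → ℂ)
    (hθ : ∀ j, ‖θ j‖ ≤ 1) :
    ∑ a : ZMod p, ‖∑ j ∈ T, θ j * ZMod.stdAddChar (a * g j)‖ ^ (2 * k) ≤
      ∑ a : ZMod p, ‖expSum T g a‖ ^ (2 * k) := by
  have h1 : ∀ a : ZMod p, ‖∑ j ∈ T, θ j * ZMod.stdAddChar (a * g j)‖ ^ (2 * k) =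
      ‖∑ x, powCoeff k T g θ x * ZMod.stdAddChar (a * x)‖ ^ 2 := by
    intro a
    rw [← weighted_expSum_pow, norm_pow, ← pow_mul, mul_comm k]
  rw [sum_norm_expSum_pow_eq]
  simp only [h1]
  rw [sum_norm_sq_fourier]
  gcongr with x
  exact norm_powCoeff_le k T g θ hθ x

/-- Hölder's inequality with exponents tailored to the bilinear bound. -/
lemma sum_mul_pow_le {I : Type*} (S : Finset I) (j G : I → ℝ) (hj : ∀ i, 0 ≤ j i)
    (hG : ∀ i, 0 ≤ G i) {k : ℕ} (hk : 0 < k) :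
    (∑ i ∈ S, j i * G i) ^ (2 * k) ≤
      (∑ i ∈ S, j i) ^ (2 * (k - 1)) * ((∑ i ∈ S, j i ^ 2) * ∑ i ∈ S, G i ^ (2 * k)) := by
  have h1 : (∑ i ∈ S, j i * G i) ^ k ≤ (∑ i ∈ S, j i) ^ (k - 1) * ∑ i ∈ S, j i * G i ^ k := by
    rcases eq_or_lt_of_le (Finset.sum_nonneg fun i (_ : i ∈ S) => hj i) with h0 | h0
    · have hz := (Finset.sum_eq_zero_iff_of_nonneg fun i _ => hj i).1 h0.symm
      have : ∑ i ∈ S, j i * G i = 0 := Finset.sum_eq_zero fun i hi => by rw [hz i hi, zero_mul]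
      rw [this, zero_pow hk.ne']
      exact mul_nonneg (pow_nonneg h0.le _) (Finset.sum_nonneg fun i _ =>
        mul_nonneg (hj i) (pow_nonneg (hG i) _))
    · set J := ∑ i ∈ S, j i with hJ
      have h2 := Real.pow_arith_mean_le_arith_mean_pow S (fun i => j i / J) G
        (fun i _ => div_nonneg (hj i) h0.le) (by rw [← Finset.sum_div, ← hJ, div_self h0.ne'])
        (fun i _ => hG i) k
      simp only [div_mul_eq_mul_div, ← Finset.sum_div] at h2
      rw [div_pow, div_le_div_iff₀ (by positivity) h0] at h2
      have h3 : J ^ k = J ^ (k - 1) * J := by rw [← pow_succ, Nat.sub_add_cancel hk]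
      rw [h3] at h2
      refine le_of_mul_le_mul_right (h2.trans_eq ?_) h0
      ring
  have h4 : (∑ i ∈ S, j i * G i ^ k) ^ 2 ≤ (∑ i ∈ S, j i ^ 2) * ∑ i ∈ S, G i ^ (2 * k) := by
    refine (Finset.sum_mul_sq_le_sq_mul_sq S j fun i => G i ^ k).trans_eq ?_
    simp only [← pow_mul, mul_comm k]
  have h0 : 0 ≤ ∑ i ∈ S, j i * G i := Finset.sum_nonneg fun i _ => mul_nonneg (hj i) (hG i)
  calc (∑ i ∈ S, j i * G i) ^ (2 * k) = ((∑ i ∈ S, j i * G i) ^ k) ^ 2 := by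
        rw [← pow_mul, mul_comm]
    _ ≤ ((∑ i ∈ S, j i) ^ (k - 1) * ∑ i ∈ S, j i * G i ^ k) ^ 2 :=
        pow_le_pow_left₀ (pow_nonneg h0 k) h1 2
    _ = (∑ i ∈ S, j i) ^ (2 * (k - 1)) * (∑ i ∈ S, j i * G i ^ k) ^ 2 := by
        rw [mul_pow, ← pow_mul, mul_comm (k - 1)]
    _ ≤ _ := by
        have : 0 ≤ (∑ i ∈ S, j i) ^ (2 * (k - 1)) :=
          pow_nonneg (Finset.sum_nonneg fun i _ => hj i) _
        gcongr

lemma exists_norm_pow_eq (z : ℂ) (l : ℕ) : ∃ θ : ℂ, ‖θ‖ ≤ 1 ∧ ((‖z‖ ^ l : ℝ) : ℂ) = θ * z ^ l := by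
  rcases eq_or_ne z 0 with rfl | hz
  · exact ⟨1, by simp, by simp⟩
  · refine ⟨((‖z‖ : ℂ) / z) ^ l, ?_, ?_⟩
    · simp [hz]
    · rw [← mul_pow, div_mul_cancel₀ _ hz]
      push_cast
      rfl

/-- A bilinear sum at a frequency `a ≠ 0` is controlled by even moments of the two factors. -/
theorem norm_expSum_mul_pow_le {p : ℕ} [Fact p.Prime] {ι κ : Type*} {A : Finset ι} {B : Finset κ}
    (hA : A.Nonempty) (hB : B.Nonempty) (f : ι → ZMod p) (g : κ → ZMod p) {k l : ℕ} (hk : 0 < k)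
    (hl : 0 < l) {a : ZMod p} (ha : a ≠ 0) :
    (‖expSum (A ×ˢ B) (fun z => f z.1 * g z.2) a‖ / (A ×ˢ B).card) ^ (2 * k * l) ≤
      p * (moment (2 * k) A f * moment (2 * l) B g) := by
  have hp0 : (0 : ℝ) < p := Nat.cast_pos.2 (NeZero.pos p)
  have hA0 : (0 : ℝ) < A.card := Nat.cast_pos.2 hA.card_pos
  have hB0 : (0 : ℝ) < B.card := Nat.cast_pos.2 hB.card_pos
  set z : ι → ℂ := fun m => expSum B g (a * f m) with hz
  choose θ hθ1 hθ2 using fun m => exists_norm_pow_eq (z m) l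
  set G : ZMod p → ℂ := fun x => ∑ m ∈ A, θ m * ZMod.stdAddChar (x * a * f m) with hG
  have hW : expSum (A ×ˢ B) (fun z => f z.1 * g z.2) a = ∑ m ∈ A, z m := by
    simp only [hz, expSum, Finset.sum_product, mul_assoc]
  have h1 : ‖expSum (A ×ˢ B) (fun z => f z.1 * g z.2) a‖ ^ l ≤
      (A.card : ℝ) ^ (l - 1) * ∑ m ∈ A, ‖z m‖ ^ l := by
    obtain ⟨n, rfl⟩ : ∃ n, l = n + 1 := ⟨l - 1, by omega⟩
    rw [hW, Nat.add_sub_cancel]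
    exact (pow_le_pow_left₀ (norm_nonneg _) (norm_sum_le _ _) _).trans
      (pow_sum_le_card_mul_sum_pow (fun _ _ => norm_nonneg _) n)
  have hzpow : ∀ m, z m ^ l = ∑ x, powCoeff l B g 1 x * ZMod.stdAddChar (a * f m * x) := by
    intro m
    rw [← weighted_expSum_pow]
    simp [hz, expSum]
  -- opening the `l`-th powers turns the inner variables into a single one, `x`
  have h2 : ∑ m ∈ A, ‖z m‖ ^ l ≤ ∑ x, ‖powCoeff l B g 1 x‖ * ‖G x‖ := by
    have h3 : ((∑ m ∈ A, ‖z m‖ ^ l : ℝ) : ℂ) = ∑ x, powCoeff l B g 1 x * G x := by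
      rw [Complex.ofReal_sum]
      simp only [hθ2, hzpow, hG, Finset.mul_sum]
      rw [Finset.sum_comm]
      refine Finset.sum_congr rfl fun x _ => Finset.sum_congr rfl fun m _ => ?_
      rw [show a * f m * x = x * a * f m by ring]
      ring
    have h4 : ∑ m ∈ A, ‖z m‖ ^ l = ‖((∑ m ∈ A, ‖z m‖ ^ l : ℝ) : ℂ)‖ := by
      rw [Complex.norm_real, Real.norm_of_nonneg (by positivity)]
    rw [h4, h3]
    refine (norm_sum_le _ _).trans_eq ?_
    simp only [norm_mul]
  have h5 : ∑ x, ‖G x‖ ^ (2 * k) ≤ ∑ x, ‖expSum A f x‖ ^ (2 * k) := by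
    refine le_trans (le_of_eq ?_) (sum_norm_weighted_expSum_pow_le k A f θ hθ1)
    exact Fintype.sum_equiv (Equiv.mulRight₀ a ha) _ _ fun x => rfl
  have h6 := sum_mul_pow_le Finset.univ (fun x => ‖powCoeff l B g 1 x‖) (fun x => ‖G x‖)
    (fun x => norm_nonneg _) (fun x => norm_nonneg _) hk
  rw [sum_norm_powCoeff_one] at h6
  have h7 := sum_norm_expSum_pow_eq l B g
  have hmA : ∑ x, ‖expSum A f x‖ ^ (2 * k) = p * (A.card : ℝ) ^ (2 * k) * moment (2 * k) A f := by
    simp only [moment, div_pow, ← Finset.sum_div]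
    field_simp
  have hmB : ∑ x, ‖powCoeff l B g 1 x‖ ^ 2 = (B.card : ℝ) ^ (2 * l) * moment (2 * l) B g := by
    simp only [moment, div_pow, ← Finset.sum_div, h7]
    field_simp
  rw [div_pow, div_le_iff₀ (by rw [Finset.card_product]; push_cast; positivity)]
  calc ‖expSum (A ×ˢ B) (fun z => f z.1 * g z.2) a‖ ^ (2 * k * l)
      = (‖expSum (A ×ˢ B) (fun z => f z.1 * g z.2) a‖ ^ l) ^ (2 * k) := by
        rw [← pow_mul, mul_comm]
    _ ≤ ((A.card : ℝ) ^ (l - 1) * ∑ x, ‖powCoeff l B g 1 x‖ * ‖G x‖) ^ (2 * k) := by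
        refine pow_le_pow_left₀ (by positivity) (h1.trans ?_) _
        gcongr
    _ = ((A.card : ℝ) ^ (l - 1)) ^ (2 * k) * (∑ x, ‖powCoeff l B g 1 x‖ * ‖G x‖) ^ (2 * k) := by
        rw [mul_pow]
    _ ≤ ((A.card : ℝ) ^ (l - 1)) ^ (2 * k) * (((B.card : ℝ) ^ l) ^ (2 * (k - 1)) *
        ((∑ x, ‖powCoeff l B g 1 x‖ ^ 2) * ∑ x, ‖expSum A f x‖ ^ (2 * k))) := by
        refine mul_le_mul_of_nonneg_left (h6.trans ?_) (by positivity)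
        gcongr
    _ = p * (moment (2 * k) A f * moment (2 * l) B g) * ((A ×ˢ B).card : ℝ) ^ (2 * k * l) := by
        rw [hmA, hmB, Finset.card_product]
        obtain ⟨k, rfl⟩ : ∃ n, k = n + 1 := ⟨k - 1, by omega⟩
        obtain ⟨l, rfl⟩ : ∃ n, l = n + 1 := ⟨l - 1, by omega⟩
        push_cast
        simp only [← pow_mul, mul_pow]
        ring

end Bilinear

/-! ### The number of solutions in a box -/

section Counting

lemma natCast_mul_doubleFactorialCount {p : ℕ} [NeZero p] (r K M L N : ℕ) (lam : ℤ) :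
    (p : ℂ) * doubleFactorialCount p r K M L N lam =
      ∑ a : ZMod p, expSum (Finset.Icc (K + 1) (K + M) ×ˢ Finset.Icc (L + 1) (L + N))
        (factorialMulMod p) a ^ r * ZMod.stdAddChar (a * -(lam : ZMod p)) := by
  set S := Finset.Icc (K + 1) (K + M) ×ˢ Finset.Icc (L + 1) (L + N) with hS
  have h1 : ∀ a : ZMod p, expSum S (factorialMulMod p) a ^ r *
      ZMod.stdAddChar (a * -(lam : ZMod p)) =
      ∑ j ∈ Fintype.piFinset fun _ : Fin r => S,
        ZMod.stdAddChar (a * (∑ i, factorialMulMod p (j i) - (lam : ZMod p))) := by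
    intro a
    have h := prod_expSum S (factorialMulMod p) (fun _ : Fin r => a)
    rw [Finset.prod_const, Finset.card_univ, Fintype.card_fin] at h
    rw [h, Finset.sum_mul]
    refine Finset.sum_congr rfl fun j _ => ?_
    rw [← AddChar.map_add_eq_mul, ← Finset.mul_sum, sub_eq_add_neg, mul_add]
  simp only [h1]
  rw [Finset.sum_comm]
  simp only [sum_stdAddChar_mul]
  rw [← Finset.sum_filter, Finset.sum_const, nsmul_eq_mul, mul_comm]
  congr 2
  rw [doubleFactorialCount]
  refine Finset.card_nbij' (fun z i => (z.1 i, z.2 i))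
    (fun j => (fun i => (j i).1, fun i => (j i).2))
    ?_ ?_ (fun _ _ => rfl) (fun _ _ => rfl)
  · intro z hz
    simp only [Finset.coe_filter, Finset.mem_product, Fintype.mem_piFinset,
      Set.mem_ofPred_eq, hS] at hz ⊢
    refine ⟨fun i => ⟨hz.1.1 i, hz.1.2 i⟩, ?_⟩
    have h2 := (ZMod.intCast_eq_intCast_iff _ _ _).2 hz.2
    rw [sub_eq_zero, ← h2]
    push_cast
    exact Finset.sum_congr rfl fun i _ => mul_comm _ _
  · intro j hj
    simp only [Finset.coe_filter, Finset.mem_product, Fintype.mem_piFinset,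
      Set.mem_ofPred_eq, hS] at hj ⊢
    refine ⟨⟨fun i => (hj.1 i).1, fun i => (hj.1 i).2⟩, ?_⟩
    refine (ZMod.intCast_eq_intCast_iff _ _ _).1 ?_
    have h2 := sub_eq_zero.1 hj.2
    rw [← h2]
    push_cast
    exact Finset.sum_congr rfl fun i _ => mul_comm _ _

/-- The error term, given a bound `δ` for the normalised sums at the nonzero frequencies. -/
lemma abs_doubleFactorialCount_sub_le {p : ℕ} [NeZero p] {r K M L N d : ℕ} (hd : d ≤ r)
    (hM : 0 < M) (hN : 0 < N) (lam : ℤ) {δ : ℝ}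
    (hδ : ∀ a : ZMod p, a ≠ 0 →
      ‖expSum (Finset.Icc (K + 1) (K + M) ×ˢ Finset.Icc (L + 1) (L + N)) (factorialMulMod p) a‖ /
        (Finset.Icc (K + 1) (K + M) ×ˢ Finset.Icc (L + 1) (L + N)).card ≤ δ) (hδ0 : 0 ≤ δ) :
    |(doubleFactorialCount p r K M L N lam : ℝ) - ((M : ℝ) * N) ^ r / p| ≤
      ((M : ℝ) * N) ^ r * (δ ^ (r - d) *
        moment d (Finset.Icc (K + 1) (K + M) ×ˢ Finset.Icc (L + 1) (L + N))
          (factorialMulMod p)) := by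
  have hp0 : (0 : ℝ) < p := Nat.cast_pos.2 (NeZero.pos p)
  have hM0 : (0 : ℝ) < M := Nat.cast_pos.2 hM
  have hN0 : (0 : ℝ) < N := Nat.cast_pos.2 hN
  have h1 := natCast_mul_doubleFactorialCount (p := p) r K M L N lam
  set S := Finset.Icc (K + 1) (K + M) ×ˢ Finset.Icc (L + 1) (L + N) with hS
  have hScard : S.card = M * N := by
    rw [hS, Finset.card_product, Nat.card_Icc, Nat.card_Icc]
    congr 1 <;> omega
  have hScard' : (S.card : ℝ) = M * N := by rw [hScard]; push_cast; rfl
  rw [← Finset.add_sum_erase _ _ (Finset.mem_univ 0)] at h1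
  have h2 : expSum S (factorialMulMod p) 0 ^ r * ZMod.stdAddChar (0 * -(lam : ZMod p)) =
      ((M : ℂ) * N) ^ r := by
    simp [expSum, hScard]
  rw [h2] at h1
  have h3 : (p : ℝ) * |(doubleFactorialCount p r K M L N lam : ℝ) - ((M : ℝ) * N) ^ r / p| =
      ‖∑ a ∈ Finset.univ.erase (0 : ZMod p), expSum S (factorialMulMod p) a ^ r *
        ZMod.stdAddChar (a * -(lam : ZMod p))‖ := by
    rw [← sub_eq_iff_eq_add'] at h1
    rw [← h1, ← abs_of_pos hp0, ← abs_mul, abs_of_pos hp0, mul_sub, mul_div_cancel₀ _ hp0.ne',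
      ← Real.norm_eq_abs, ← Complex.norm_real]
    push_cast
    rfl
  refine le_of_mul_le_mul_left ?_ hp0
  rw [h3]
  have h4 : ∀ a ∈ Finset.univ.erase (0 : ZMod p), ‖expSum S (factorialMulMod p) a ^ r *
        ZMod.stdAddChar (a * -(lam : ZMod p))‖ ≤
      ((M : ℝ) * N) ^ r * (δ ^ (r - d) * (‖expSum S (factorialMulMod p) a‖ / S.card) ^ d) := by
    intro a ha
    rw [norm_mul, AddChar.norm_apply, mul_one, norm_pow]
    have h5 := hδ a (Finset.ne_of_mem_erase ha)
    have h0 : 0 ≤ ‖expSum S (factorialMulMod p) a‖ / S.card :=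
      div_nonneg (norm_nonneg _) (Nat.cast_nonneg _)
    have h6 : ‖expSum S (factorialMulMod p) a‖ =
        ((M : ℝ) * N) * (‖expSum S (factorialMulMod p) a‖ / S.card) := by
      rw [hScard', mul_div_cancel₀ _ (by positivity)]
    have h8 : ‖expSum S (factorialMulMod p) a‖ ^ r =
        ((M : ℝ) * N) ^ r * (‖expSum S (factorialMulMod p) a‖ / S.card) ^ r := by
      rw [← mul_pow, ← h6]
    rw [h8]
    refine mul_le_mul_of_nonneg_left ?_ (by positivity)
    have h9 : (‖expSum S (factorialMulMod p) a‖ / S.card) ^ r =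
        (‖expSum S (factorialMulMod p) a‖ / S.card) ^ (r - d) *
          (‖expSum S (factorialMulMod p) a‖ / S.card) ^ d := by
      rw [← pow_add, Nat.sub_add_cancel hd]
    rw [h9]
    exact mul_le_mul_of_nonneg_right (pow_le_pow_left₀ h0 h5 _) (pow_nonneg h0 _)
  refine (norm_sum_le_of_le _ h4).trans ?_
  rw [← Finset.mul_sum, ← Finset.mul_sum]
  have h7 : ∑ a ∈ Finset.univ.erase (0 : ZMod p), (‖expSum S (factorialMulMod p) a‖ / S.card) ^ d ≤
      p * moment d S (factorialMulMod p) := by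
    rw [moment, mul_div_cancel₀ _ hp0.ne']
    exact Finset.sum_le_sum_of_subset_of_nonneg (Finset.subset_univ _) fun _ _ _ => by positivity
  calc _ ≤ ((M : ℝ) * N) ^ r * (δ ^ (r - d) * (p * moment d S (factorialMulMod p))) := by gcongr
    _ = _ := by ring

/-- The bilinear bound with the moments of the two single sums inserted. -/
lemma exists_norm_expSum_factorialMul_le (k l : ℕ) (hk : 0 < k) (hl : 0 < l) : ∃ D : ℝ, 1 ≤ D ∧
    ∀ (p : ℕ) [Fact p.Prime] (K M L N : ℕ), 0 < M → 0 < N → K + M < p → L + N < p →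
      ∀ a : ZMod p, a ≠ 0 →
      ‖expSum (Finset.Icc (K + 1) (K + M) ×ˢ Finset.Icc (L + 1) (L + N)) (factorialMulMod p) a‖ /
        (Finset.Icc (K + 1) (K + M) ×ˢ Finset.Icc (L + 1) (L + N)).card ≤
      D * ((M : ℝ) ^ (-(1 / (2 * (l : ℝ) * (k + 1)))) * (N : ℝ) ^ (-(1 / (2 * (k : ℝ) * (l + 1)))) *
        (p : ℝ) ^ (1 / (2 * (k : ℝ) * l))) := by
  obtain ⟨C₁, hC₁, h1⟩ := exists_moment_factorial_le k hk
  obtain ⟨C₂, hC₂, h2⟩ := exists_moment_factorial_le l hl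
  refine ⟨1 + C₁ * C₂, by linarith [mul_pos hC₁ hC₂], fun p _ K M L N hM hN hp hq a ha => ?_⟩
  have hp0 : (0 : ℝ) < p := Nat.cast_pos.2 (NeZero.pos p)
  have hM0 : (0 : ℝ) < M := Nat.cast_pos.2 hM
  have hN0 : (0 : ℝ) < N := Nat.cast_pos.2 hN
  have hk0 : (0 : ℝ) < k := Nat.cast_pos.2 hk
  have hl0 : (0 : ℝ) < l := Nat.cast_pos.2 hl
  have h3 := norm_expSum_mul_pow_le (p := p) (A := Finset.Icc (K + 1) (K + M))
    (B := Finset.Icc (L + 1) (L + N)) (Finset.nonempty_Icc.2 (by omega))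
    (Finset.nonempty_Icc.2 (by omega)) (factorialMod p) (factorialMod p) hk hl ha
  have hkl : 2 * k * l ≠ 0 := by positivity
  refine (pow_le_pow_iff_left₀ (by positivity) (by positivity) hkl).1 (h3.trans ?_)
  -- the summand `1` makes the constant at least `1`, so that no root of `C₁ * C₂` is needed
  have hD : C₁ * C₂ ≤ (1 + C₁ * C₂) ^ (2 * k * l) := by
    have : 0 < C₁ * C₂ := mul_pos hC₁ hC₂
    exact (by linarith : C₁ * C₂ ≤ 1 + C₁ * C₂).trans (le_self_pow₀ (by linarith) hkl)
  have e1 : ((M : ℝ) ^ (-(1 / (2 * (l : ℝ) * (k + 1))))) ^ (2 * k * l) =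
      (M : ℝ) ^ (-(k : ℝ) / (k + 1)) := by
    rw [← Real.rpow_natCast, ← Real.rpow_mul hM0.le]
    congr 1
    push_cast
    field_simp
  have e2 : ((N : ℝ) ^ (-(1 / (2 * (k : ℝ) * (l + 1))))) ^ (2 * k * l) =
      (N : ℝ) ^ (-(l : ℝ) / (l + 1)) := by
    rw [← Real.rpow_natCast, ← Real.rpow_mul hN0.le]
    congr 1
    push_cast
    field_simp
  have e3 : ((p : ℝ) ^ (1 / (2 * (k : ℝ) * l))) ^ (2 * k * l) = p := by
    rw [← Real.rpow_natCast, ← Real.rpow_mul hp0.le]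
    push_cast
    rw [one_div_mul_cancel (by positivity), Real.rpow_one]
  rw [mul_pow, mul_pow, mul_pow, e1, e2, e3]
  calc p * (moment (2 * k) (Finset.Icc (K + 1) (K + M)) (factorialMod p) *
        moment (2 * l) (Finset.Icc (L + 1) (L + N)) (factorialMod p))
      ≤ p * ((C₁ * (M : ℝ) ^ (-(k : ℝ) / (k + 1))) * (C₂ * (N : ℝ) ^ (-(l : ℝ) / (l + 1)))) := by
        have := moment_nonneg (Finset.Icc (L + 1) (L + N)) (factorialMod p) (2 * l)
        have := h1 p K M hM hp
        have := h2 p L N hN hq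
        gcongr
    _ = (C₁ * C₂) * ((M : ℝ) ^ (-(k : ℝ) / (k + 1)) * (N : ℝ) ^ (-(l : ℝ) / (l + 1)) * p) := by
        ring
    _ ≤ _ := by gcongr

/-- The asymptotic formula for the number of solutions: `r - 2s` factors are bounded pointwise and
`2s` in the mean. The constant is summed over the possible `s`, to be independent of it. -/
theorem exists_abs_doubleFactorialCount_sub_le (k l r : ℕ) (hk : 0 < k) (hl : 0 < l) :
    ∃ c : ℝ, 0 < c ∧
      ∀ s : ℕ, 0 < s → (s : ℝ) ≤ (r : ℝ) / 2 →
      ∀ p : ℕ, p.Prime →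
      ∀ K M L N : ℕ, 0 < M → K + M < p → 0 < N → L + N < p →
        (M : ℝ) ≤ (N : ℝ) ^ 2 → (N : ℝ) ^ ((1 : ℝ) / 2) ≤ (M : ℝ) →
      ∀ lam : ℤ,
        |(doubleFactorialCount p r K M L N lam : ℝ) - ((M : ℝ) * (N : ℝ)) ^ r / (p : ℝ)| ≤
          c * (M : ℝ) ^ ((r : ℝ) - 1 + 1 / (2 * (s : ℝ))
                - ((r : ℝ) - 2 * (s : ℝ)) / (2 * (l : ℝ) * ((k : ℝ) + 1)))
            * (N : ℝ) ^ ((r : ℝ) - 1 / (2 * ((s : ℝ) + 1))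
                - ((r : ℝ) - 2 * (s : ℝ)) / (2 * (k : ℝ) * ((l : ℝ) + 1)))
            * (p : ℝ) ^ (((r : ℝ) - 2 * (s : ℝ)) / (2 * (k : ℝ) * (l : ℝ))) := by
  obtain ⟨D, hD, h1⟩ := exists_norm_expSum_factorialMul_le k l hk hl
  choose C hC h2 using fun s : ℕ => exists_moment_factorialMul_box_le (s + 1) s.succ_pos
  have hD0 : 0 < D := by linarith
  have hCsum : 0 ≤ ∑ s ∈ Finset.range r, C s := Finset.sum_nonneg fun s _ => (hC s).le
  refine ⟨D ^ r * (1 + ∑ s ∈ Finset.range r, C s), by positivity, ?_⟩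
  intro s hs hsr p hpp K M L N hM hp hN hq hMN hNM lam
  have : Fact p.Prime := ⟨hpp⟩
  have hsr' : 2 * s ≤ r := by
    have : (2 : ℝ) * s ≤ r := by linarith
    exact_mod_cast this
  obtain ⟨t, rfl⟩ : ∃ t, s = t + 1 := ⟨s - 1, by omega⟩
  have hp0 : (0 : ℝ) < p := Nat.cast_pos.2 (NeZero.pos p)
  have hM0 : (0 : ℝ) < M := Nat.cast_pos.2 hM
  have hN0 : (0 : ℝ) < N := Nat.cast_pos.2 hN
  have hNM2 : (N : ℝ) ≤ (M : ℝ) ^ 2 := by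
    have := pow_le_pow_left₀ (by positivity) hNM 2
    rwa [← Real.rpow_natCast, ← Real.rpow_mul hN0.le, Nat.cast_ofNat, one_div_mul_cancel two_ne_zero,
      Real.rpow_one] at this
  have h3 := h2 t p K M L N hM hN hMN hNM2 hp hq
  have h4 := abs_doubleFactorialCount_sub_le hsr' hM hN lam (h1 p K M L N hM hN hp hq)
    (by positivity)
  have hCt : C t ≤ 1 + ∑ s ∈ Finset.range r, C s := by
    have := Finset.single_le_sum (fun s _ => (hC s).le) (Finset.mem_range.2 (by omega : t < r))
    linarith
  refine h4.trans ?_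
  have hcast : ((r - 2 * (t + 1) : ℕ) : ℝ) = (r : ℝ) - 2 * ((t + 1 : ℕ) : ℝ) := by
    rw [Nat.cast_sub hsr']; push_cast; ring
  set s := t + 1 with hs_def
  have e1 : (M : ℝ) ^ ((r : ℝ) - 1 + 1 / (2 * (s : ℝ))
      - ((r : ℝ) - 2 * (s : ℝ)) / (2 * (l : ℝ) * ((k : ℝ) + 1))) =
      (M : ℝ) ^ r * ((M : ℝ) ^ (-(1 / (2 * (l : ℝ) * (k + 1))))) ^ (r - 2 * s) *
        (M : ℝ) ^ (-1 + 1 / (2 * (s : ℝ))) := by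
    rw [← Real.rpow_natCast, ← Real.rpow_natCast, ← Real.rpow_mul hM0.le, ← Real.rpow_add hM0,
      ← Real.rpow_add hM0, hcast]
    congr 1
    ring
  have e2 : (N : ℝ) ^ ((r : ℝ) - 1 / (2 * ((s : ℝ) + 1))
      - ((r : ℝ) - 2 * (s : ℝ)) / (2 * (k : ℝ) * ((l : ℝ) + 1))) =
      (N : ℝ) ^ r * ((N : ℝ) ^ (-(1 / (2 * (k : ℝ) * (l + 1))))) ^ (r - 2 * s) *
        (N : ℝ) ^ (-(1 / (2 * ((s : ℝ) + 1)))) := by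
    rw [← Real.rpow_natCast, ← Real.rpow_natCast, ← Real.rpow_mul hN0.le, ← Real.rpow_add hN0,
      ← Real.rpow_add hN0, hcast]
    congr 1
    ring
  have e3 : (p : ℝ) ^ (((r : ℝ) - 2 * (s : ℝ)) / (2 * (k : ℝ) * (l : ℝ))) =
      ((p : ℝ) ^ (1 / (2 * (k : ℝ) * l))) ^ (r - 2 * s) := by
    rw [← Real.rpow_natCast, ← Real.rpow_mul hp0.le, hcast]
    congr 1
    ring
  rw [e1, e2, e3, mul_pow, mul_pow, mul_pow, mul_pow]
  set m₁ := ((M : ℝ) ^ (-(1 / (2 * (l : ℝ) * (k + 1))))) ^ (r - 2 * s)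
  set n₁ := ((N : ℝ) ^ (-(1 / (2 * (k : ℝ) * (l + 1))))) ^ (r - 2 * s)
  set q₁ := ((p : ℝ) ^ (1 / (2 * (k : ℝ) * l))) ^ (r - 2 * s)
  set m₂ := (M : ℝ) ^ (-1 + 1 / (2 * (s : ℝ)))
  set n₂ := (N : ℝ) ^ (-(1 / (2 * ((s : ℝ) + 1))))
  calc _ ≤ (M : ℝ) ^ r * (N : ℝ) ^ r * (D ^ r * (m₁ * n₁ * q₁) *
        ((1 + ∑ s ∈ Finset.range r, C s) * (m₂ * n₂))) := by
        have hDr : D ^ (r - 2 * s) ≤ D ^ r := pow_le_pow_right₀ hD (Nat.sub_le _ _)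
        have := moment_nonneg (Finset.Icc (K + 1) (K + M) ×ˢ Finset.Icc (L + 1) (L + N))
          (factorialMulMod p) (2 * s)
        refine mul_le_mul_of_nonneg_left ?_ (by positivity)
        refine mul_le_mul ?_ (h3.trans ?_) this (by positivity)
        · gcongr
        · gcongr
    _ = _ := by ring

end Counting

/-! ### Sums of seven products of two factorials -/

section Seven

variable {p : ℕ} [Fact p.Prime]

/-- A form of Wilson's theorem. -/
lemma factorial_mul_factorial_sub_mod (n : ℕ) (hn : n < p) :
    factorialMod p n * factorialMod p (p - 1 - n) = (-1) ^ (n + 1) := by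
  induction n with
  | zero => simp [factorialMod]
  | succ n ih =>
    have h1 := ih (by omega)
    have h2 : p - 1 - n = (p - 1 - (n + 1)) + 1 := by omega
    have h3 : ((p - 1 - (n + 1) + 1 : ℕ) : ZMod p) = -((n + 1 : ℕ) : ZMod p) := by
      rw [eq_neg_iff_add_eq_zero, ← Nat.cast_add]
      rw [show p - 1 - (n + 1) + 1 + (n + 1) = p by omega, CharP.cast_eq_zero]
    rw [h2, factorialMod, factorialMod, Nat.factorial_succ, Nat.cast_mul, h3] at h1
    rw [factorialMod, factorialMod, Nat.factorial_succ, Nat.cast_mul, pow_succ, ← h1]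
    ring

/-- The products of two factorials of positive integers below `p` cover more than half of the
residue classes: `n! * (p - n)! = n` for even `n`, and `1! * 1! = 1`. -/
lemma lt_two_mul_card_image_factorialMul (hp : Odd p) :
    p < 2 * ((Finset.Icc 1 (p - 1) ×ˢ Finset.Icc 1 (p - 1)).image (factorialMulMod p)).card := by
  have hp2 := (Fact.out : p.Prime).two_le
  obtain ⟨q, hq⟩ := hp
  have h1 : (Finset.range (q + 1)).card ≤
      ((Finset.Icc 1 (p - 1) ×ˢ Finset.Icc 1 (p - 1)).image (factorialMulMod p)).card := by
    refine Finset.card_le_card_of_injOn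
      (fun i => ((if i = 0 then 1 else 2 * i : ℕ) : ZMod p)) ?_ ?_
    · intro i hi
      rw [Finset.coe_range, Set.mem_Iio] at hi
      rw [Finset.mem_coe, Finset.mem_image]
      rcases Nat.eq_zero_or_pos i with rfl | hi0
      · refine ⟨(1, 1), ?_, by simp [factorialMulMod]⟩
        simp only [Finset.mem_product, Finset.mem_Icc]
        omega
      · refine ⟨(2 * i, p - 2 * i), ?_, ?_⟩
        · simp only [Finset.mem_product, Finset.mem_Icc]
          omega
        · have h2 := factorial_mul_factorial_sub_mod (p := p) (2 * i - 1) (by omega)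
          rw [show 2 * i - 1 + 1 = 2 * i by omega, show p - 1 - (2 * i - 1) = p - 2 * i by omega,
            pow_mul, neg_one_sq, one_pow, factorialMod, factorialMod] at h2
          simp only [factorialMulMod, if_neg hi0.ne']
          rw [← Nat.mul_factorial_pred (by omega : 2 * i ≠ 0), Nat.cast_mul, mul_assoc, h2, mul_one]
    · intro i hi j hj hij
      rw [Finset.coe_range, Set.mem_Iio] at hi hj
      have h3 := (ZMod.natCast_eq_natCast_iff' _ _ _).1 hij
      rw [Nat.mod_eq_of_lt (by split_ifs <;> omega), Nat.mod_eq_of_lt (by split_ifs <;> omega)] at h3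
      split_ifs at h3 <;> omega
  rw [Finset.card_range] at h1
  omega

/-- With all factorials up to `(p - 1)!` available, two products already represent every residue
class, by the pigeonhole principle; the other five are taken to be `1! * 1!`. -/
lemma exists_sum_seven_of_full_range (hp : Odd p) (lam : ℤ) : ∃ m n : Fin 7 → ℕ,
    (∀ i, 1 ≤ m i ∧ m i ≤ p - 1) ∧ (∀ i, 1 ≤ n i ∧ n i ≤ p - 1) ∧
      (∑ i, (((m i)! * (n i)! : ℕ) : ℤ)) ≡ lam [ZMOD (p : ℤ)] := by
  have hp2 := (Fact.out : p.Prime).two_le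
  set A := (Finset.Icc 1 (p - 1) ×ˢ Finset.Icc 1 (p - 1)).image (factorialMulMod p) with hA
  set x : ZMod p := (lam : ZMod p) - 5 with hx
  have h1 : (A ∩ A.image fun y => x - y).Nonempty := by
    refine Finset.inter_nonempty_of_card_lt_card_add_card (Finset.subset_univ _)
      (Finset.subset_univ _) ?_
    rw [Finset.card_image_of_injective _ (sub_right_injective), Finset.card_univ, ZMod.card,
      ← two_mul]
    exact lt_two_mul_card_image_factorialMul hp
  obtain ⟨y, hy⟩ := h1
  obtain ⟨hy1, hy2⟩ := Finset.mem_inter.1 hy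
  obtain ⟨y', hy', hyy⟩ := Finset.mem_image.1 hy2
  obtain ⟨⟨m₀, n₀⟩, h₀, e₀⟩ := Finset.mem_image.1 hy1
  obtain ⟨⟨m₁, n₁⟩, h₁, e₁⟩ := Finset.mem_image.1 hy'
  simp only [Finset.mem_product, Finset.mem_Icc] at h₀ h₁
  refine ⟨![m₀, m₁, 1, 1, 1, 1, 1], ![n₀, n₁, 1, 1, 1, 1, 1], ?_, ?_, ?_⟩
  · intro i
    fin_cases i <;> simp <;> omega
  · intro i
    fin_cases i <;> simp <;> omega
  · refine (ZMod.intCast_eq_intCast_iff _ _ _).1 ?_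
    have e₂ : factorialMulMod p (m₀, n₀) + factorialMulMod p (m₁, n₁) = (lam : ZMod p) - 5 := by
      rw [e₀, e₁, ← hyy, hx]
      ring
    simp only [factorialMulMod] at e₂
    simp only [Fin.sum_univ_seven, Matrix.cons_val, Nat.factorial_one]
    push_cast
    linear_combination e₂

end Seven

lemma exists_sum_of_doubleFactorialCount_pos {p r N : ℕ} {lam : ℤ}
    (h : 0 < doubleFactorialCount p r 0 N 0 N lam) : ∃ m n : Fin r → ℕ,
    (∀ i, 1 ≤ m i ∧ m i ≤ N) ∧ (∀ i, 1 ≤ n i ∧ n i ≤ N) ∧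
      (∑ i, (((m i)! * (n i)! : ℕ) : ℤ)) ≡ lam [ZMOD (p : ℤ)] := by
  obtain ⟨⟨m, n⟩, hz⟩ := Finset.card_pos.1 h
  simp only [Finset.mem_filter, Finset.mem_product, Fintype.mem_piFinset, Finset.mem_Icc,
    zero_add] at hz
  refine ⟨m, n, hz.1.1, hz.1.2, ?_⟩
  simpa only [mul_comm] using hz.2

/-- The asymptotic formula with `k = l = s = 2` and `r = 7` has a positive main term exceeding the
error as soon as `N` is a large multiple of `p ^ (33 / 34)`. -/
theorem exists_sum_seven_factorialMul : ∃ C : ℝ, 0 < C ∧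
    ∀ p : ℕ, p.Prime → Odd p →
      ∃ N : ℕ, 0 < N ∧ N < p ∧ (N : ℝ) ≤ C * (p : ℝ) ^ ((33 : ℝ) / 34) ∧
        ∀ lam : ℤ, ∃ m n : Fin 7 → ℕ,
          (∀ i, 1 ≤ m i ∧ m i ≤ N) ∧ (∀ i, 1 ≤ n i ∧ n i ≤ N) ∧
          (∑ i, (((m i)! * (n i)! : ℕ) : ℤ)) ≡ lam [ZMOD (p : ℤ)] := by
  obtain ⟨c, hc, h⟩ := exists_abs_doubleFactorialCount_sub_le 2 2 7 two_pos two_pos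
  refine ⟨2 * (c + 1), by positivity, fun p hp hodd => ?_⟩
  have : Fact p.Prime := ⟨hp⟩
  have hp2 := hp.two_le
  have hp1 : (1 : ℝ) ≤ p := Nat.one_le_cast.2 hp.one_le
  have hp0 : (0 : ℝ) < p := by linarith
  have hq1 : (1 : ℝ) ≤ (p : ℝ) ^ ((33 : ℝ) / 34) := Real.one_le_rpow hp1 (by norm_num)
  set y : ℝ := (c + 1) * (p : ℝ) ^ ((33 : ℝ) / 34) with hy
  have hy1 : 1 ≤ y := one_le_mul_of_one_le_of_one_le (by linarith) hq1
  set N := ⌈y⌉₊ with hN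
  have hyN : y ≤ N := Nat.le_ceil y
  have hN1 : (1 : ℝ) ≤ N := hy1.trans hyN
  have hN0 : (0 : ℝ) < N := by linarith
  have hNpos : 0 < N := Nat.cast_pos.1 hN0
  rcases lt_or_ge N p with hNp | hNp
  · refine ⟨N, hNpos, hNp, (ceil_le_two_mul hy1).trans_eq (by rw [hy]; ring), fun lam => ?_⟩
    refine exists_sum_of_doubleFactorialCount_pos ?_
    have hN2 : (N : ℝ) ≤ (N : ℝ) ^ 2 := by nlinarith
    have hN3 : (N : ℝ) ^ ((1 : ℝ) / 2) ≤ N := by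
      calc (N : ℝ) ^ ((1 : ℝ) / 2) ≤ (N : ℝ) ^ (1 : ℝ) :=
            Real.rpow_le_rpow_of_exponent_le hN1 (by norm_num)
        _ = N := Real.rpow_one _
    have h1 := h 2 two_pos (by norm_num) p hp 0 N 0 N hNpos (by omega) hNpos (by omega) hN2 hN3 lam
    norm_num at h1
    have hbig : c * (p : ℝ) ^ ((11 : ℝ) / 8) < (N : ℝ) ^ ((17 : ℝ) / 12) := by
      have h2 : y ^ ((17 : ℝ) / 12) = (c + 1) ^ ((17 : ℝ) / 12) * (p : ℝ) ^ ((11 : ℝ) / 8) := by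
        rw [hy, Real.mul_rpow (by positivity) (by positivity), ← Real.rpow_mul hp0.le]
        norm_num
      have h3 : c + 1 ≤ (c + 1) ^ ((17 : ℝ) / 12) := by
        calc c + 1 = (c + 1) ^ (1 : ℝ) := (Real.rpow_one _).symm
          _ ≤ _ := Real.rpow_le_rpow_of_exponent_le (by linarith) (by norm_num)
      calc c * (p : ℝ) ^ ((11 : ℝ) / 8) < (c + 1) ^ ((17 : ℝ) / 12) * (p : ℝ) ^ ((11 : ℝ) / 8) := by
            gcongr
            linarith
        _ = y ^ ((17 : ℝ) / 12) := h2.symm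
        _ ≤ _ := Real.rpow_le_rpow (by linarith) hyN (by norm_num)
    have hsmall : c * (N : ℝ) ^ 6 * (N : ℝ) ^ ((79 : ℝ) / 12) * (p : ℝ) ^ ((3 : ℝ) / 8) <
        ((N : ℝ) * N) ^ 7 / p := by
      have h2 : (N : ℝ) ^ ((79 : ℝ) / 12) * (N : ℝ) ^ ((17 : ℝ) / 12) = (N : ℝ) ^ 8 := by
        rw [← Real.rpow_add hN0, ← Real.rpow_natCast]
        norm_num
      have h3 : (p : ℝ) ^ ((3 : ℝ) / 8) * p = (p : ℝ) ^ ((11 : ℝ) / 8) := by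
        rw [← Real.rpow_add_one hp0.ne']
        norm_num
      rw [lt_div_iff₀ hp0]
      calc c * (N : ℝ) ^ 6 * (N : ℝ) ^ ((79 : ℝ) / 12) * (p : ℝ) ^ ((3 : ℝ) / 8) * p
          = (N : ℝ) ^ 6 * (N : ℝ) ^ ((79 : ℝ) / 12) * (c * (p : ℝ) ^ ((11 : ℝ) / 8)) := by
            rw [← h3]; ring
        _ < (N : ℝ) ^ 6 * (N : ℝ) ^ ((79 : ℝ) / 12) * (N : ℝ) ^ ((17 : ℝ) / 12) := by gcongr
        _ = ((N : ℝ) * N) ^ 7 := by rw [mul_assoc, h2]; ring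
    have hpos : (0 : ℝ) < doubleFactorialCount p 7 0 N 0 N lam := by
      linarith [(abs_le.1 h1).1]
    exact_mod_cast hpos
  · refine ⟨p - 1, by omega, by omega, ?_, exists_sum_seven_of_full_range hodd⟩
    have h1 : ((p - 1 : ℕ) : ℝ) < y := by
      rw [← Nat.lt_ceil]
      omega
    refine h1.le.trans ?_
    rw [hy]
    nlinarith

theorem theorem5 :
    (∀ k l r : ℕ, 0 < k → 0 < l → 0 < r →
      ∃ c : ℝ, 0 < c ∧
        ∀ s : ℕ, 0 < s → (s : ℝ) ≤ (r : ℝ) / 2 →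
        ∀ p : ℕ, p.Prime → Odd p →
        ∀ K M L N : ℕ, 0 < M → K + M < p → 0 < N → L + N < p →
          (M : ℝ) ≤ (N : ℝ) ^ 2 → (N : ℝ) ^ ((1 : ℝ) / 2) ≤ (M : ℝ) →
        ∀ lam : ℤ,
          |(doubleFactorialCount p r K M L N lam : ℝ) - ((M : ℝ) * (N : ℝ)) ^ r / (p : ℝ)| ≤
            c * (M : ℝ) ^ ((r : ℝ) - 1 + 1 / (2 * (s : ℝ))
                  - ((r : ℝ) - 2 * (s : ℝ)) / (2 * (l : ℝ) * ((k : ℝ) + 1)))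
              * (N : ℝ) ^ ((r : ℝ) - 1 / (2 * ((s : ℝ) + 1))
                  - ((r : ℝ) - 2 * (s : ℝ)) / (2 * (k : ℝ) * ((l : ℝ) + 1)))
              * (p : ℝ) ^ (((r : ℝ) - 2 * (s : ℝ)) / (2 * (k : ℝ) * (l : ℝ)))) ∧
    (∃ C : ℝ, 0 < C ∧
      ∀ p : ℕ, p.Prime → Odd p →
        ∃ N : ℕ, 0 < N ∧ N < p ∧ (N : ℝ) ≤ C * (p : ℝ) ^ ((33 : ℝ) / 34) ∧
          ∀ lam : ℤ, ∃ m n : Fin 7 → ℕ,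
            (∀ i, 1 ≤ m i ∧ m i ≤ N) ∧ (∀ i, 1 ≤ n i ∧ n i ≤ N) ∧
            (∑ i, (((m i)! * (n i)! : ℕ) : ℤ)) ≡ lam [ZMOD (p : ℤ)]) := by
  refine ⟨fun k l r hk hl _ => ?_, exists_sum_seven_factorialMul⟩
  obtain ⟨c, hc, h⟩ := exists_abs_doubleFactorialCount_sub_le k l r hk hl
  exact ⟨c, hc, fun s hs hsr p hp _ => h s hs hsr p hp⟩
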